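/- **Conventions.** All algebras are associative $\mathbb C$-algebras, not necessarily with unit; $[a,b]=ab-ba$, $\{a,b\}=ab+ba$. Let $\mathbf t=(t_1,t_3,t_5,\ldots)$ be real (or complex) variables and let $D$ be a set of sequences $\mathbf t$ that contains with each point a neighbourhood of it in every coordinate direction. "Smooth" means that all iterated partial derivatives exist on $D$ and do not depend on the order of differentiation. *KP hierarchy.* Let $B$ be an algebra with commuting derivations $\partial_{t_1},\partial_{t_2},\partial_{t_3},\ldots$, and for $f\in B$ put $f_{[\lambda]}=\exp\big(\sum_{j\ge1}\frac{\lambda^j}{j}\partial_{t_j}\big)f\in B[[\lambda]]$. A pair $\phi,\tilde\theta\in B$ solves the KP hierarchy if, in every order in $\lambda$, $$\lambda^{-1}(\phi_{[\lambda]}-\phi)-\tfrac12(\phi_{[\lambda]}+\phi)_{t_1}-\tfrac12(\phi_{[\lambda]}-\phi)^2+\tfrac12[\phi,\phi_{[\lambda]}]=\tilde\theta_{[\lambda]}-\tilde\theta .$$ *Odd KP hierarchy.* An equation of the odd KP hierarchy is $P=0$, where $P$ is a noncommutative polynomial with complex coefficients and without constant term in the derivatives of $\phi$ and $\tilde\theta$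 (of all orders $\ge0$) with respect to odd-numbered variables only, such that $P=0$ is a consequence of the KP hierarchy, i.e. holds for all its solutions in all algebras $B$ as above. Let $\mathcal A$ be one of the algebras considered below. Smooth functions $\phi,\theta:D\to\mathcal A$ solve the odd KP hierarchy in $\mathcal A$, with the smooth function $W$ as the integral $\int[\phi,\phi_{t_1}]\,dt_1$, if $W_{t_1}=[\phi,\phi_{t_1}]$ and $\phi$ and $\tilde\theta=\theta+\frac12W$ satisfy all these equations on $D$. With the integral $J=\int[\phi_{t_3},\phi_{t_1}]\,dt_1:=\frac12(W_{t_3}-[\phi,\phi_{t_3}])$, the *odd KP system* consists of $J_{t_1}=[\phi_{t_3},\phi_{t_1}]$ and the two equations $$\begin{aligned}&\Big(9\phi_{t_5}-5\phi_{t_1t_1t_3}+\phi_{t_1t_1t_1t_1t_1}-\tfrac{15}2\{\phi_{t_1},\phi_{t_3}-\phi_{t_1t_1t_1}-\phi_{t_1}^2\}+\tfrac{45}4(\phi_{t_1t_1}^2-4\theta_{t_1}^2)\Big)_{t_1}-5\phi_{t_3t_3}\\&+15\Big([\phi_{t_1},\theta_{t_3}-\theta_{t_1t_1t_1}]+[\theta_{t_1},\phi_{t_3}+\tfrac12\phi_{t_1t_1t_1}]+\tfrac32[\theta_{t_1t_1},\phi_{t_1t_1}]+[\phi_{t_1},J]\Big)=0,\end{aligned}$$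 $$\begin{aligned}&\Big[9\theta_{t_5}-5\theta_{t_1t_1t_3}+\theta_{t_1t_1t_1t_1t_1}+\tfrac{15}2\Big(-\{\phi_{t_3},\theta_{t_1}\}+\{\theta_{t_1t_1t_1},\phi_{t_1}\}+\tfrac12\{\theta_{t_1},\phi_{t_1t_1}\}_{t_1}+6\phi_{t_1}\theta_{t_1}\phi_{t_1}\\&+\tfrac16[\phi_{t_3},\phi_{t_1t_1}]+\tfrac16[\phi_{t_1},\phi_{t_1t_1}]_{t_1t_1}-\tfrac14[\phi_{t_1t_1},\phi_{t_1t_1t_1}]\Big)\Big]_{t_1}-5\theta_{t_3t_3}-\tfrac{15}2\{\theta_{t_1},\phi_{t_1}\}_{t_3}\\&+15[\theta_{t_1},\theta_{t_3}+\tfrac12\theta_{t_1t_1t_1}+J]+45[\theta_{t_1}^2,\phi_{t_1}]+15[\phi_{t_1t_1},[\phi_{t_1},\theta_{t_1}]]+\tfrac{15}2[[\theta_{t_1},\phi_{t_1t_1}],\phi_{t_1}]\\&+\tfrac{25}4[\phi_{t_1t_1t_3},\phi_{t_1}]-5J_{t_3}+\tfrac{15}2[\phi_{t_3}-\phi_{t_1t_1t_1},\phi_{t_1}^2]+\tfrac{45}4[\phi_{t_1},\phi_{t_1t_1}^2]=0.\end{aligned}$$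 The odd KP$_Q$ hierarchy (system), for an $N\times M$ matrix $Q$, is the odd KP hierarchy (system) in the algebra of complex $M\times N$ matrices with product $A\circ B=AQB$; the $m\times m$ matrix odd KP hierarchy (system) is the one in the algebra of complex $m\times m$ matrices, and the scalar one is the one in $\mathbb C$. **Proposition 5.1.** Let $R,Q,S,L$ be constant complex $N\times N$, $N\times M$, $M\times N$, $M\times M$ matrices, and let $\begin{pmatrix}R_n&Q_n\\S_n&L_n\end{pmatrix}=\begin{pmatrix}R&Q\\S&L\end{pmatrix}^n$. Let the $M\times N$ matrix function $\Phi$ solve the odd Riccati hierarchy $$\Phi_{t_n}=S_n+L_n\Phi-\Phi R_n-\Phi Q_n\Phi\qquad(n=1,3,5,\ldots)$$ on $D$, let $W$ be any smooth function with $W_{t_1}=\Phi Q\Phi_{t_1}-\Phi_{t_1}Q\Phi$ on $D$, i.e. $W=\int(\Phi Q\Phi_{t_1}-\Phi_{t_1}Q\Phi)\,dt_1$, and let $$\Theta=\tfrac12\Big(L\Phi+\Phi R-\int(\Phi Q\Phi_{t_1}-\Phi_{t_1}Q\Phi)\,dt_1\Big)=\tfrac12(L\Phi+\Phi R-W).$$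 1. $\Phi$ and $\Theta$ solve the odd KP$_Q$ hierarchy with $W$ as the integral, and in particular the odd KP$_Q$ system. 2. If $Q=VU^{\intercal}$ with an $M\times m$ matrix $U$ and an $N\times m$ matrix $V$, then $\phi=U^{\intercal}\Phi V$ and $\theta=U^{\intercal}\Theta V$ solve the $m\times m$ matrix odd KP hierarchy with $U^{\intercal}WV$ as the integral, and in particular the $m\times m$ matrix odd KP system. 3. If $Q=VU^{\intercal}$ with $m=1$, then $\phi=U^{\intercal}\Phi V$ and $\theta=\frac12U^{\intercal}(L\Phi+\Phi R)V$ solve the scalar odd KP hierarchy with $0$ as the integral, and in particular $$\begin{aligned}\Big(9\phi_{t_5}-5\phi_{t_1t_1t_3}+\phi_{t_1t_1t_1t_1t_1}-15\phi_{t_3}\phi_{t_1}+15\phi_{t_1}\phi_{t_1t_1t_1}+15\phi_{t_1}^3+\tfrac{45}4\phi_{t_1t_1}^2-45\theta_{t_1}^2\Big)_{t_1}-5\phi_{t_3t_3}&=0,\\ \Big(9\theta_{t_5}-5\theta_{t_1t_1t_3}+\theta_{t_1t_1t_1t_1t_1}-15\phi_{t_3}\theta_{t_1}+15\phi_{t_1}\theta_{t_1t_1t_1}+\tfrac{15}2(\phi_{t_1t_1}\theta_{t_1})_{t_1}+45\phi_{t_1}^2\theta_{t_1}\Big)_{t_1}-5(\theta_{t_3}+3\phi_{t_1}\theta_{t_1})_{t_3}&=0.\end{aligned}$$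 -/

import Mathlib

open Topology Matrix

namespace OddKP

/-! ## The KP hierarchy with its auxiliary variable, in differential algebras

The dependent variables take values in a possibly noncommutative associative algebra,
which need not have a unit (rectangular matrices with the product `A * Q * B` occur below). -/

section Formal

variable {B : Type*} [NonUnitalRing B] [Module ℂ B]

/-- `miwa d f k` is the coefficient of `lam ^ k` in the Miwa shift
`f(t + [lam]) = exp (∑_{j ≥ 1} (lam ^ j / j) d_j) f`, where `[lam] = (lam, lam ^ 2 / 2, lam ^ 3 / 3, …)`
and `d_j` is the derivation with respect to `t_j`. Differentiating the exponential with respect to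
`lam` gives the recursion `(k + 1) f_{k+1} = ∑_{j = 0}^{k} d_{j+1} f_{k-j}`, with `f_0 = f`. -/
noncomputable def miwa (d : ℕ+ → B →ₗ[ℂ] B) (f : B) : ℕ → B
  | 0 => f
  | k + 1 => ((k : ℂ) + 1)⁻¹ • ∑ j : Fin (k + 1), d (Nat.succPNat j) (miwa d f (k - j))
decreasing_by omega

/-- `φ` and `θ` solve the KP hierarchy in the differential algebra
`(B, d)`: the `d n` are commuting derivations (`d n` plays the role of `∂ / ∂ t_n`), and the
functional equation
`lam⁻¹ (φ' - φ) - (φ' + φ)_{t_1} / 2 - (φ' - φ) ^ 2 / 2 + [φ, φ'] / 2 = θ' - θ`,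
where a prime is the Miwa shift by `[lam]`, holds in every order `lam ^ k`. The orders `k ≤ 0` are
identities. -/
structure IsKPSolution (d : ℕ+ → B →ₗ[ℂ] B) (φ θ : B) : Prop where
  leibniz : ∀ n a b, d n (a * b) = d n a * b + a * d n b
  comm : ∀ m n a, d m (d n a) = d n (d m a)
  kp : ∀ k : ℕ, 1 ≤ k →
    miwa d φ (k + 1) - (1 / 2 : ℂ) • d 1 (miwa d φ k)
      - (1 / 2 : ℂ) • ∑ i ∈ Finset.Ico 1 k, miwa d φ i * miwa d φ (k - i)
      + (1 / 2 : ℂ) • (φ * miwa d φ k - miwa d φ k * φ) = miwa d θ k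

end Formal

/-! ## Differential polynomials in the odd-numbered variables, and the odd KP hierarchy -/

/-- The indices of the odd-numbered variables `t_1, t_3, t_5, …`. -/
abbrev OddTime : Type := {n : ℕ+ // Odd (n : ℕ)}

/-- Symbols for the iterated partial derivatives of the two dependent variables with respect to
odd-numbered variables. The head of the list is the derivative that is applied last. -/
inductive JetSymbol : Type
  | phi (w : List OddTime)
  | theta (w : List OddTime)

/-- Noncommutative differential polynomials without constant term, in two dependent variables and
their derivatives with respect to the odd-numbered variables: the free associative (non-unital)
algebra on the jet symbols. -/
abbrev OddDiffPoly : Type := MonoidAlgebra ℂ (FreeSemigroup JetSymbol)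

/-- Substitution of elements of an algebra for the jet symbols. -/
noncomputable def OddDiffPoly.eval {A : Type*} [NonUnitalRing A] [Module ℂ A] [IsScalarTower ℂ A A]
    [SMulCommClass ℂ A A] (x : JetSymbol → A) : OddDiffPoly →ₙₐ[ℂ] A :=
  MonoidAlgebra.liftMagma ℂ (FreeSemigroup.lift x)

/-- The jets of a pair of elements of a differential algebra. -/
def formalJet {B : Type*} [NonUnitalRing B] [Module ℂ B] (d : ℕ+ → B →ₗ[ℂ] B) (φ θ : B) :
    JetSymbol → B
  | .phi w => w.foldr (fun n f => d n f) φ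
  | .theta w => w.foldr (fun n f => d n f) θ

/-- The equation `P = 0` belongs to the odd KP hierarchy: it contains only derivatives with respect
to odd-numbered variables, and it is a consequence of the KP hierarchy (in the formulation with the
auxiliary variable), that is, it holds for all solutions of the KP hierarchy in all differential
algebras. So these are the equations that result from the KP hierarchy by elimination of all
derivatives with respect to even-numbered variables. -/
def IsOddKPEquation (P : OddDiffPoly) : Prop :=
  ∀ (B : Type) [NonUnitalRing B] [Module ℂ B] [IsScalarTower ℂ B B] [SMulCommClass ℂ B B]
    (d : ℕ+ → B →ₗ[ℂ] B) (φ θ : B),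
    IsKPSolution d φ θ → OddDiffPoly.eval (formalJet d φ θ) P = 0

/-! ## Functions of the odd-numbered variables -/

section Functions

variable {𝕜 : Type*} [RCLike 𝕜]

/-- `D` contains with each point a neighbourhood of it in every coordinate direction. (Open sets of
any of the usual spaces of sequences have this property, also if they are regarded as subsets of
the space of all sequences.) -/
def OddOpen (D : Set (OddTime → 𝕜)) : Prop :=
  ∀ t ∈ D, ∀ n : OddTime, ∀ᶠ s in 𝓝 (t n), Function.update t n s ∈ D

section Derivatives

variable {A : Type*} [AddCommGroup A] [Module 𝕜 A] [TopologicalSpace A]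

/-- The partial derivative with respect to `t_n`. -/
noncomputable def pd (n : OddTime) (f : (OddTime → 𝕜) → A) : (OddTime → 𝕜) → A :=
  fun t => deriv (fun s => f (Function.update t n s)) (t n)

/-- Iterated partial derivatives; the head of the list is applied last. -/
noncomputable def iterPd (w : List OddTime) (f : (OddTime → 𝕜) → A) : (OddTime → 𝕜) → A :=
  w.foldr pd f

/-- All iterated partial derivatives exist on `D`, and their order is immaterial. -/
structure OddSmoothOn (D : Set (OddTime → 𝕜)) (f : (OddTime → 𝕜) → A) : Prop where
  diff : ∀ (w : List OddTime) (n : OddTime), ∀ t ∈ D,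
    DifferentiableAt 𝕜 (fun s => iterPd w f (Function.update t n s)) (t n)
  symm : ∀ (w : List OddTime) (m n : OddTime), ∀ t ∈ D,
    iterPd (m :: n :: w) f t = iterPd (n :: m :: w) f t

/-- The jets of a pair of functions at a point. -/
noncomputable def jetAt (φ θ : (OddTime → 𝕜) → A) (t : OddTime → 𝕜) : JetSymbol → A
  | .phi w => iterPd w φ t
  | .theta w => iterPd w θ t

end Derivatives

def t1 : OddTime := ⟨1, by decide⟩
def t3 : OddTime := ⟨3, by decide⟩
def t5 : OddTime := ⟨5, by decide⟩

/-- Commutator. -/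
def com {X : Type*} [NonUnitalRing X] (a b : X) : X := a * b - b * a

/-- Anti-commutator. -/
def acom {X : Type*} [NonUnitalRing X] (a b : X) : X := a * b + b * a

variable {A : Type*} [NonUnitalRing A] [Module 𝕜 A] [TopologicalSpace A] [Module ℂ A]

/-- `φ` and `θ` solve the odd KP hierarchy on `D`, with `W` as the (choice of the) integral
`∫ [φ, φ_{t_1}] d t_1` in the relation `θ + (1/2) ∫ [φ, φ_{t_1}] d t_1` between `θ` and the second
dependent variable of the integral-free formulation. -/
structure SolvesOddKP [IsScalarTower ℂ A A] [SMulCommClass ℂ A A] (D : Set (OddTime → 𝕜))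
    (φ θ W : (OddTime → 𝕜) → A) : Prop where
  smooth_phi : OddSmoothOn D φ
  smooth_theta : OddSmoothOn D θ
  smooth_integral : OddSmoothOn D W
  integral : ∀ t ∈ D, pd t1 W t = com φ (pd t1 φ) t
  equations : ∀ P : OddDiffPoly, IsOddKPEquation P → ∀ t ∈ D,
    OddDiffPoly.eval (jetAt φ (θ + (1 / 2 : ℂ) • W) t) P = 0

/-- The integral `∫ [φ_{t_3}, φ_{t_1}] d t_1` that belongs to the choice `W` of the integral
`∫ [φ, φ_{t_1}] d t_1`, namely `(W_{t_3} - [φ, φ_{t_3}]) / 2`. -/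
noncomputable def integral31 (φ W : (OddTime → 𝕜) → A) : (OddTime → 𝕜) → A :=
  (1 / 2 : ℂ) • (pd t3 W - com φ (pd t3 φ))

/-- The odd KP system (the first member of the odd KP hierarchy) for `φ` and `θ`, with `J` as the
integral `∫ [φ_{t_3}, φ_{t_1}] d t_1`. -/
structure SolvesOddKPSystem (D : Set (OddTime → 𝕜)) (φ θ J : (OddTime → 𝕜) → A) : Prop where
  integral : ∀ t ∈ D, pd t1 J t = com (pd t3 φ) (pd t1 φ) t
  eq1 : ∀ t ∈ D,
    ( pd t1 ( (9 : ℂ) • pd t5 φ - (5 : ℂ) • iterPd [t1, t1, t3] φ + iterPd [t1, t1, t1, t1, t1] φ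
        - (15 / 2 : ℂ) • acom (pd t1 φ) (pd t3 φ - iterPd [t1, t1, t1] φ - pd t1 φ * pd t1 φ)
        + (45 / 4 : ℂ) • (iterPd [t1, t1] φ * iterPd [t1, t1] φ
            - (4 : ℂ) • (pd t1 θ * pd t1 θ)) )
      - (5 : ℂ) • iterPd [t3, t3] φ
      + (15 : ℂ) • ( com (pd t1 φ) (pd t3 θ - iterPd [t1, t1, t1] θ)
        + com (pd t1 θ) (pd t3 φ + (1 / 2 : ℂ) • iterPd [t1, t1, t1] φ)
        + (3 / 2 : ℂ) • com (iterPd [t1, t1] θ) (iterPd [t1, t1] φ)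
        + com (pd t1 φ) J ) ) t = 0
  eq2 : ∀ t ∈ D,
    ( pd t1 ( (9 : ℂ) • pd t5 θ - (5 : ℂ) • iterPd [t1, t1, t3] θ + iterPd [t1, t1, t1, t1, t1] θ
        + (15 / 2 : ℂ) • ( - acom (pd t3 φ) (pd t1 θ) + acom (iterPd [t1, t1, t1] θ) (pd t1 φ)
          + (1 / 2 : ℂ) • pd t1 (acom (pd t1 θ) (iterPd [t1, t1] φ))
          + (6 : ℂ) • (pd t1 φ * pd t1 θ * pd t1 φ)
          + (1 / 6 : ℂ) • com (pd t3 φ) (iterPd [t1, t1] φ)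
          + (1 / 6 : ℂ) • iterPd [t1, t1] (com (pd t1 φ) (iterPd [t1, t1] φ))
          - (1 / 4 : ℂ) • com (iterPd [t1, t1] φ) (iterPd [t1, t1, t1] φ) ) )
      - (5 : ℂ) • iterPd [t3, t3] θ
      - (15 / 2 : ℂ) • pd t3 (acom (pd t1 θ) (pd t1 φ))
      + (15 : ℂ) • com (pd t1 θ) (pd t3 θ + (1 / 2 : ℂ) • iterPd [t1, t1, t1] θ + J)
      + (45 : ℂ) • com (pd t1 θ * pd t1 θ) (pd t1 φ)
      + (15 : ℂ) • com (iterPd [t1, t1] φ) (com (pd t1 φ) (pd t1 θ))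
      + (15 / 2 : ℂ) • com (com (pd t1 θ) (iterPd [t1, t1] φ)) (pd t1 φ)
      + (25 / 4 : ℂ) • com (iterPd [t1, t1, t3] φ) (pd t1 φ)
      - (5 : ℂ) • pd t3 J
      + (15 / 2 : ℂ) • com (pd t3 φ - iterPd [t1, t1, t1] φ) (pd t1 φ * pd t1 φ)
      + (45 / 4 : ℂ) • com (pd t1 φ) (iterPd [t1, t1] φ * iterPd [t1, t1] φ) ) t = 0

end Functions

/-- The form of the odd KP system for scalar functions. -/
structure SolvesScalarOddKPSystem {𝕜 : Type*} [RCLike 𝕜] [NormedAlgebra 𝕜 ℂ] (D : Set (OddTime → 𝕜))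
    (φ θ : (OddTime → 𝕜) → ℂ) : Prop where
  eq1 : ∀ t ∈ D,
    (( pd t1 ( (9 : ℂ) • pd t5 φ - (5 : ℂ) • iterPd [t1, t1, t3] φ + iterPd [t1, t1, t1, t1, t1] φ
        - (15 : ℂ) • (pd t3 φ * pd t1 φ) + (15 : ℂ) • (pd t1 φ * iterPd [t1, t1, t1] φ)
        + (15 : ℂ) • (pd t1 φ) ^ 3 + (45 / 4 : ℂ) • (iterPd [t1, t1] φ) ^ 2
        - (45 : ℂ) • (pd t1 θ) ^ 2 )
      - (5 : ℂ) • iterPd [t3, t3] φ : (OddTime → 𝕜) → ℂ )) t = 0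
  eq2 : ∀ t ∈ D,
    (( pd t1 ( (9 : ℂ) • pd t5 θ - (5 : ℂ) • iterPd [t1, t1, t3] θ + iterPd [t1, t1, t1, t1, t1] θ
        - (15 : ℂ) • (pd t3 φ * pd t1 θ) + (15 : ℂ) • (pd t1 φ * iterPd [t1, t1, t1] θ)
        + (15 / 2 : ℂ) • pd t1 (iterPd [t1, t1] φ * pd t1 θ)
        + (45 : ℂ) • ((pd t1 φ) ^ 2 * pd t1 θ) )
      - (5 : ℂ) • pd t3 (pd t3 θ + (3 : ℂ) • (pd t1 φ * pd t1 θ)) : (OddTime → 𝕜) → ℂ )) t = 0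


/-! ## The `Q`-modified product -/

/-- The `M × N` matrices with the product `X ∘ Y = X * Q * Y`. The odd KP hierarchy in this algebra
is the odd `KP_Q` hierarchy. -/
def QMat {M N : ℕ} (_Q : Matrix (Fin N) (Fin M) ℂ) : Type := Matrix (Fin M) (Fin N) ℂ

section QMat

variable {M N : ℕ} (Q : Matrix (Fin N) (Fin M) ℂ)

noncomputable instance instNonUnitalRing : NonUnitalRing (QMat Q) :=
  { (inferInstance : AddCommGroup (Matrix (Fin M) (Fin N) ℂ)) with
    mul := fun (X Y : Matrix (Fin M) (Fin N) ℂ) => X * Q * Y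
    left_distrib := fun (X Y Z : Matrix (Fin M) (Fin N) ℂ) => Matrix.mul_add (X * Q) Y Z
    right_distrib := fun (X Y Z : Matrix (Fin M) (Fin N) ℂ) => by
      change (X + Y) * Q * Z = X * Q * Z + Y * Q * Z
      rw [Matrix.add_mul, Matrix.add_mul]
    zero_mul := fun (X : Matrix (Fin M) (Fin N) ℂ) => by
      change (0 : Matrix (Fin M) (Fin N) ℂ) * Q * X = 0
      rw [Matrix.zero_mul, Matrix.zero_mul]
    mul_zero := fun (X : Matrix (Fin M) (Fin N) ℂ) => Matrix.mul_zero (X * Q)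
    mul_assoc := fun (X Y Z : Matrix (Fin M) (Fin N) ℂ) => by
      change X * Q * Y * Q * Z = X * Q * (Y * Q * Z)
      simp only [Matrix.mul_assoc] }

noncomputable instance instModule {K : Type*} [Semiring K] [Module K ℂ] : Module K (QMat Q) :=
  (inferInstance : Module K (Matrix (Fin M) (Fin N) ℂ))

noncomputable instance instTopologicalSpace : TopologicalSpace (QMat Q) :=
  (inferInstance : TopologicalSpace (Matrix (Fin M) (Fin N) ℂ))

instance instIsScalarTower : IsScalarTower ℂ (QMat Q) (QMat Q) where
  smul_assoc := fun c (X Y : Matrix (Fin M) (Fin N) ℂ) => by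
    change (c • X) * Q * Y = c • (X * Q * Y)
    rw [Matrix.smul_mul, Matrix.smul_mul]

instance instSMulCommClass : SMulCommClass ℂ (QMat Q) (QMat Q) where
  smul_comm := fun c (X Y : Matrix (Fin M) (Fin N) ℂ) => by
    change c • (X * Q * Y) = X * Q * (c • Y)
    rw [Matrix.mul_smul]

end QMat

/-! ## The odd Riccati hierarchy -/

section Riccati

variable {M N : ℕ}

/-- The right hand side `S_n + L_n X - X R_n - X Q_n X` of the `n`-th matrix Riccati equation, where
`R_n, Q_n, S_n, L_n` are the blocks of the `n`-th power of `H`. -/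
noncomputable def riccatiRHS (H : Matrix (Fin N ⊕ Fin M) (Fin N ⊕ Fin M) ℂ) (n : ℕ)
    (X : Matrix (Fin M) (Fin N) ℂ) : Matrix (Fin M) (Fin N) ℂ :=
  (H ^ n).toBlocks₂₁ + (H ^ n).toBlocks₂₂ * X - X * (H ^ n).toBlocks₁₁
    - X * (H ^ n).toBlocks₁₂ * X

/-- `Φ` solves the odd Riccati hierarchy on `D`. -/
def SolvesOddRiccati {𝕜 : Type*} [RCLike 𝕜] [NormedAlgebra 𝕜 ℂ]
    (H : Matrix (Fin N ⊕ Fin M) (Fin N ⊕ Fin M) ℂ) (D : Set (OddTime → 𝕜))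
    (Φ : (OddTime → 𝕜) → Matrix (Fin M) (Fin N) ℂ) : Prop :=
  ∀ (n : OddTime), ∀ t ∈ D,
    HasDerivAt (fun s => Φ (Function.update t n s)) (riccatiRHS H (n : ℕ+) (Φ t)) (t n)

end Riccati

end OddKP

/-! The odd equations are identities in a differential algebra attached to the Riccati hierarchy, so
no even-time dependence of `Φ` is needed. Let `X` be a generic `M × N` matrix, and let `d_k X = S_k
+ L_k X - X R_k - X Q_k X` define derivations of the polynomials in its entries for every `k ≥ 1`,
even `k` included. These derivations commute, and in the algebra of polynomial matrices with product
`a Q b` the pair `X`, `(L X + X R) / 2` solves the full KP hierarchy (`PolyMat.isKPSolution`).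
Evaluating the indeterminates at `Φ t` is an algebra homomorphism, which by the chain rule turns the
odd `d_k` into partial derivatives. It therefore carries every odd consequence of KP to `Φ`
(`IsRealization.solvesOddKP`). If `Q = V Uᵀ`, then `X ↦ Uᵀ X V` is a further homomorphism, and
composing with it gives the compressed solutions.

KP holds because the Riccati flows are linear flows of graphs: `d_k` moves the graph of `X` by `H ^
k`. Since `∑ lam ^ j H ^ j / j = -log (1 - lam H)`, the Miwa shift moves the graph by `(1 - lam
H)⁻¹`. With `P` the projection onto the second summand along the graph, the shifted graph is the
image of `(1 - lam P H)⁻¹` applied to the column `(1, X)`. The coefficients `y_k` of the shifted `X`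
thus satisfy `y_{k+1} = (L - X Q) y_k` for `k ≥ 1`. Together with the first Riccati equation for the
shifted matrix (`matDer_miwaMat`), this reduces KP to linear algebra in each order.

The explicit system follows from the orders 1 to 4 of KP. They express `d_2` and `d_4` of both
dependent variables through odd derivatives, and the compatibility of `d_2` with `d_4` leaves two
equations without even times (`odd_equation_phi`, `odd_equation_h`). -/

namespace OddKP

/-! ### Elimination of the even-numbered variables from the first four orders of KP. -/

section FormalSystem

variable {B : Type*} [NonUnitalRing B] [Module ℂ B]

section MiwaCoefficients

variable (d : ℕ+ → B →ₗ[ℂ] B) (f : B)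

theorem miwa_zero : miwa d f 0 = f := by rw [miwa]

theorem miwa_one : miwa d f 1 = d 1 f := by
  rw [miwa]
  simp [miwa_zero, show Nat.succPNat 0 = 1 from rfl]

theorem miwa_two : miwa d f 2 = (1 / 2 : ℂ) • (d 1 (d 1 f) + d 2 f) := by
  rw [miwa]
  simp [Fin.sum_univ_succ, miwa_zero, miwa_one, show Nat.succPNat 0 = 1 from rfl,
    show Nat.succPNat 1 = 2 from rfl]
  norm_num

theorem miwa_three :
    miwa d f 3 = (1 / 3 : ℂ) • (d 1 (miwa d f 2) + d 2 (d 1 f) + d 3 f) := by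
  rw [miwa]
  simp [Fin.sum_univ_succ, miwa_zero, miwa_one, show Nat.succPNat 0 = 1 from rfl,
    show Nat.succPNat 1 = 2 from rfl, show Nat.succPNat 2 = 3 from rfl, add_assoc]
  norm_num

theorem miwa_four :
    miwa d f 4 = (1 / 4 : ℂ) • (d 1 (miwa d f 3) + d 2 (miwa d f 2) + d 3 (d 1 f) + d 4 f) := by
  rw [miwa]
  simp [Fin.sum_univ_succ, miwa_zero, miwa_one, show Nat.succPNat 0 = 1 from rfl,
    show Nat.succPNat 1 = 2 from rfl, show Nat.succPNat 2 = 3 from rfl,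
    show Nat.succPNat 3 = 4 from rfl, add_assoc]
  norm_num

theorem miwa_five :
    miwa d f 5 = (1 / 5 : ℂ) • (d 1 (miwa d f 4) + d 2 (miwa d f 3) + d 3 (miwa d f 2)
      + d 4 (d 1 f) + d 5 f) := by
  rw [miwa]
  simp [Fin.sum_univ_succ, miwa_zero, miwa_one, show Nat.succPNat 0 = 1 from rfl,
    show Nat.succPNat 1 = 2 from rfl, show Nat.succPNat 2 = 3 from rfl,
    show Nat.succPNat 3 = 4 from rfl, show Nat.succPNat 4 = 5 from rfl, add_assoc]
  norm_num

end MiwaCoefficients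

/-- The derivative of `h - (1/2) ∫ [φ, φ_{t_n}] d t_n` with respect to `t_n`. -/
noncomputable def kappa (d : ℕ+ → B →ₗ[ℂ] B) (φ h : B) (n : ℕ+) : B :=
  d n h - (1 / 2 : ℂ) • com φ (d n φ)

/-- Trading `d n h` for `kappa` makes undifferentiated `φ` drop out of the KP equations. For `h = θ
+ W / 2`, `kappa 1` is `θ_{t_1}` and `kappa 3` is `θ_{t_3} + J`. -/
theorem d_eq_kappa_add (d : ℕ+ → B →ₗ[ℂ] B) (φ h : B) (n : ℕ+) :
    d n h = kappa d φ h n + (1 / 2 : ℂ) • com φ (d n φ) := by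
  rw [kappa, sub_add_cancel]

variable [IsScalarTower ℂ B B] [SMulCommClass ℂ B B] {d : ℕ+ → B →ₗ[ℂ] B} {φ h : B}

namespace IsKPSolution

variable (hs : IsKPSolution d φ h)
include hs

omit [IsScalarTower ℂ B B] [SMulCommClass ℂ B B] in
-- The `kappa n` are not the derivatives of a single element; the commutator measures the failure of
-- integrability. For the pair 3, 1 it is the source of the integral `J`.
theorem d_kappa (m n : ℕ+) :
    d m (kappa d φ h n) = d n (kappa d φ h m) - com (d m φ) (d n φ) := by
  simp only [kappa, com, map_sub, map_smul, hs.leibniz, hs.comm m n]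
  module

omit [IsScalarTower ℂ B B] [SMulCommClass ℂ B B] in
-- In each order the highest derivatives are `d (k + 1) φ` and `d k h`. Hence orders 1 and 3
-- determine `d 2 φ` and `d 4 φ`, and orders 2 and 4 determine `kappa 2` and `kappa 4`.
theorem d_two_phi : d 2 φ = (2 : ℂ) • kappa d φ h 1 := by
  have e := hs.kp 1 le_rfl
  simp only [Nat.reduceAdd, miwa_two, miwa_one, Finset.Ico_self, Finset.sum_empty,
    d_eq_kappa_add d φ h] at e
  linear_combination (norm := skip) (2 : ℂ) • e
  simp only [com]
  module

theorem kappa_two : kappa d φ h 2 = (2 / 3 : ℂ) • d 3 φ - (1 / 6 : ℂ) • d 1 (d 1 (d 1 φ))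
    - d 1 φ * d 1 φ := by
  have e := hs.kp 2 (by norm_num)
  have c : d 2 (d 1 φ) = d 1 (d 2 φ) := hs.comm _ _ _
  simp only [Nat.reduceAdd, miwa_three, miwa_two, miwa_one, Nat.Ico_succ_singleton,
    Finset.sum_singleton, d_eq_kappa_add d φ h, c, hs.d_two_phi, Nat.reduceSub, com, map_add, map_sub,
    map_smul, hs.leibniz] at e
  linear_combination (norm := skip) (-2 : ℂ) • e
  -- Once products are expanded, noncommutative monomials are atoms and the identity is linear in
  -- them.
  simp only [mul_add, add_mul, smul_mul_assoc, mul_smul_comm]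
  module

theorem d_four_phi : d 4 φ = (4 / 3 : ℂ) • kappa d φ h 3
    + (2 / 3 : ℂ) • d 1 (d 1 (kappa d φ h 1)) + (2 : ℂ) • acom (kappa d φ h 1) (d 1 φ)
    + (1 / 3 : ℂ) • com (d 1 φ) (d 1 (d 1 φ)) := by
  have e := hs.kp 3 (by norm_num)
  simp only [Nat.reduceAdd, miwa_four, miwa_three, miwa_two, miwa_one,
    Finset.sum_Ico_succ_top, Nat.reduceLeDiff, Finset.Ico_self, Finset.sum_empty, zero_add,
    d_eq_kappa_add d φ h, hs.comm 2 1, hs.comm 3 1, hs.d_two_phi, hs.d_kappa 2 1, hs.kappa_two,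
    Nat.reduceSub, com, map_add, map_sub, map_smul, hs.leibniz] at e
  linear_combination (norm := skip) (4 : ℂ) • e
  simp only [com, acom, mul_add, add_mul, smul_mul_assoc, mul_smul_comm]
  module

theorem kappa_four : kappa d φ h 4 = (4 / 5 : ℂ) • d 5 φ - (1 / 3 : ℂ) • d 1 (d 1 (d 3 φ))
    + (1 / 30 : ℂ) • d 1 (d 1 (d 1 (d 1 (d 1 φ)))) - (2 / 3 : ℂ) • acom (d 1 φ) (d 3 φ)
    + (1 / 6 : ℂ) • acom (d 1 φ) (d 1 (d 1 (d 1 φ))) + (1 / 2 : ℂ) • (d 1 (d 1 φ) * d 1 (d 1 φ))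
    - (2 : ℂ) • (kappa d φ h 1 * kappa d φ h 1) + com (d 1 (kappa d φ h 1)) (d 1 φ) := by
  have e := hs.kp 4 (by norm_num)
  simp only [Nat.reduceAdd, miwa_five, miwa_four, miwa_three, miwa_two, miwa_one,
    Finset.sum_Ico_succ_top, Nat.reduceLeDiff, Finset.Ico_self, Finset.sum_empty, zero_add,
    d_eq_kappa_add d φ h, hs.comm 2 1, hs.comm 3 1, hs.comm 4 1, hs.comm 2 3, hs.d_two_phi,
    hs.d_four_phi, hs.d_kappa 2 1, hs.d_kappa 3 1, hs.kappa_two,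
    Nat.reduceSub, com, acom, map_add, map_sub, map_smul, hs.leibniz] at e
  linear_combination (norm := skip) (-4 : ℂ) • e
  simp only [com, acom, mul_add, add_mul, mul_sub, sub_mul, smul_mul_assoc, mul_smul_comm,
    mul_assoc]
  module

/-- This is the compatibility condition `d 4 (d 2 φ) = d 2 (d 4 φ)` after elimination of the even
derivatives. -/
theorem odd_equation_phi :
    d 1 ((9 : ℂ) • d 5 φ - (5 : ℂ) • d 1 (d 1 (d 3 φ)) + d 1 (d 1 (d 1 (d 1 (d 1 φ))))
        - (15 / 2 : ℂ) • acom (d 1 φ) (d 3 φ - d 1 (d 1 (d 1 φ)) - d 1 φ * d 1 φ)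
        + (45 / 4 : ℂ) • (d 1 (d 1 φ) * d 1 (d 1 φ)
            - (4 : ℂ) • (kappa d φ h 1 * kappa d φ h 1)))
      - (5 : ℂ) • d 3 (d 3 φ)
      + (15 : ℂ) • (com (d 1 φ) (kappa d φ h 3 - d 1 (d 1 (kappa d φ h 1)))
        + com (kappa d φ h 1) (d 3 φ + (1 / 2 : ℂ) • d 1 (d 1 (d 1 φ)))
        + (3 / 2 : ℂ) • com (d 1 (kappa d φ h 1)) (d 1 (d 1 φ))) = 0 := by
  have e := hs.comm 4 2 φ
  simp only [hs.d_two_phi, hs.d_four_phi, hs.comm 2 1, hs.comm 3 1, hs.d_kappa 2 1,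
    hs.d_kappa 2 3, hs.d_kappa 4 1, hs.kappa_two, hs.kappa_four, com, acom,
    map_add, map_sub, map_smul, hs.leibniz] at e
  -- The only fifth-time term comes from `2 • d 1 (kappa 4)` and is `8 / 5` times `d 1 (d 5 φ)`; the
  -- factor normalises it to 9.
  linear_combination (norm := skip) (45 / 8 : ℂ) • e
  simp only [com, acom, map_add, map_sub, map_smul, hs.leibniz, mul_add, add_mul,
    mul_sub, sub_mul, smul_mul_assoc, mul_smul_comm, mul_assoc]
  module

/-- This is the relation `d_kappa 4 2` after elimination. As `θ` has no counterpart in `B`, its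
derivatives enter only through `kappa 1` and `kappa 3`; this is why the fifth-time term stands
outside `d 1`, and why `θ_{t_3 t_3}` and `J_{t_3}` appear together as `d 3 (kappa 3)`. -/
theorem odd_equation_h :
    (9 : ℂ) • d 5 (kappa d φ h 1)
      + d 1 (- (5 : ℂ) • d 1 (d 3 (kappa d φ h 1)) + d 1 (d 1 (d 1 (d 1 (kappa d φ h 1))))
        + (15 / 2 : ℂ) • ( - acom (d 3 φ) (kappa d φ h 1)
          + acom (d 1 (d 1 (kappa d φ h 1))) (d 1 φ)
          + (1 / 2 : ℂ) • d 1 (acom (kappa d φ h 1) (d 1 (d 1 φ)))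
          + (6 : ℂ) • (d 1 φ * kappa d φ h 1 * d 1 φ)
          + (1 / 6 : ℂ) • com (d 3 φ) (d 1 (d 1 φ))
          + (1 / 6 : ℂ) • d 1 (d 1 (com (d 1 φ) (d 1 (d 1 φ))))
          - (1 / 4 : ℂ) • com (d 1 (d 1 φ)) (d 1 (d 1 (d 1 φ)))))
      - (5 : ℂ) • d 3 (kappa d φ h 3)
      - (15 / 2 : ℂ) • d 3 (acom (kappa d φ h 1) (d 1 φ))
      + (15 : ℂ) • com (kappa d φ h 1)
          (kappa d φ h 3 + (1 / 2 : ℂ) • d 1 (d 1 (kappa d φ h 1)))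
      + (45 : ℂ) • com (kappa d φ h 1 * kappa d φ h 1) (d 1 φ)
      + (15 : ℂ) • com (d 1 (d 1 φ)) (com (d 1 φ) (kappa d φ h 1))
      + (15 / 2 : ℂ) • com (com (kappa d φ h 1) (d 1 (d 1 φ))) (d 1 φ)
      + (25 / 4 : ℂ) • com (d 1 (d 1 (d 3 φ))) (d 1 φ)
      + (15 / 2 : ℂ) • com (d 3 φ - d 1 (d 1 (d 1 φ))) (d 1 φ * d 1 φ)
      + (45 / 4 : ℂ) • com (d 1 φ) (d 1 (d 1 φ) * d 1 (d 1 φ)) = 0 := by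
  have e := hs.d_kappa 4 2
  have c : d 5 (kappa d φ h 1) = d 1 (kappa d φ h 5) - com (d 5 φ) (d 1 φ) := hs.d_kappa 5 1
  have c5 : d 2 (d 5 φ) = d 5 (d 2 φ) := hs.comm _ _ _
  simp only [hs.d_two_phi, hs.d_four_phi, hs.comm 2 1, hs.comm 3 1, hs.comm 4 1, hs.comm 2 3,
    hs.comm 4 3, c5, hs.d_kappa 2 1, hs.d_kappa 3 1, c,
    hs.kappa_two, hs.kappa_four, com, acom, map_add, map_sub, map_smul, hs.leibniz] at e
  linear_combination (norm := skip) (-45 / 8 : ℂ) • e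
  simp only [hs.comm 3 1, hs.d_kappa 3 1, c, com, acom, map_add, map_sub, map_neg, map_smul,
    hs.leibniz, mul_add, add_mul, mul_sub, sub_mul, smul_mul_assoc,
    mul_smul_comm, mul_assoc]
  module

end IsKPSolution
end FormalSystem

/-! ### Rules of differentiation for curves in topological vector spaces; the matrix algebras are
used with a topology only, without a norm. -/

section TopologicalVectorSpace

variable {𝕜 E F : Type*} [NontriviallyNormedField 𝕜] [AddCommGroup E] [Module 𝕜 E]
  [TopologicalSpace E] [ContinuousSMul 𝕜 E] [AddCommGroup F] [Module 𝕜 F]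
  [TopologicalSpace F] [ContinuousSMul 𝕜 F]

theorem hasDerivAt_clm_comp (g : E →L[𝕜] F) {f : 𝕜 → E} {f' : E} {x : 𝕜}
    (h : HasDerivAt f f' x) : HasDerivAt (fun s => g (f s)) (g f') x := by
  rw [hasDerivAt_iff_hasFDerivAt] at h ⊢
  refine .of_isLittleOTVS ?_
  refine (g.isBigOTVS_comp.trans_isLittleOTVS h.isLittleOTVS).congr_left fun p => ?_
  simp

theorem hasDerivAt_add [ContinuousAdd E] {f g : 𝕜 → E} {f' g' : E} {x : 𝕜}
    (hf : HasDerivAt f f' x) (hg : HasDerivAt g g' x) :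
    HasDerivAt (fun s => f s + g s) (f' + g') x := by
  rw [hasDerivAt_iff_hasFDerivAt] at hf hg ⊢
  refine .of_isLittleOTVS ?_
  refine (hf.isLittleOTVS.add hg.isLittleOTVS).congr_left fun p => ?_
  simp only [Pi.add_apply, ContinuousLinearMap.toSpanSingleton_apply, smul_add]
  abel

theorem hasDerivAt_pi_of_forall {ι : Type*} {E : ι → Type*} [∀ i, AddCommGroup (E i)]
    [∀ i, Module 𝕜 (E i)] [∀ i, TopologicalSpace (E i)] [∀ i, ContinuousSMul 𝕜 (E i)]
    {f : 𝕜 → ∀ i, E i} {f' : ∀ i, E i} {x : 𝕜} (h : ∀ i, HasDerivAt (fun s => f s i) (f' i) x) :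
    HasDerivAt f f' x := by
  rw [hasDerivAt_iff_hasFDerivAt]
  refine .of_isLittleOTVS (Asymptotics.IsLittleOTVS.pi fun i => ?_)
  exact (hasDerivAt_iff_hasFDerivAt.1 (h i)).isLittleOTVS.congr_left fun p => by simp

theorem deriv_eq_of_hasDerivAt [ContinuousAdd E] [T2Space E] {f : 𝕜 → E} {f' : E} {x : 𝕜}
    (h : HasDerivAt f f' x) : deriv f x = f' := by
  have := (hasDerivAt_iff_hasFDerivAt.1 h).fderiv
  simp [deriv, this]

end TopologicalVectorSpace

/-! ### Partial derivatives and families of jets. -/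

section PartialDerivatives

variable {𝕜 : Type*} [RCLike 𝕜] {A : Type*} [AddCommGroup A] [Module 𝕜 A] [TopologicalSpace A]
  [ContinuousSMul 𝕜 A] {D : Set (OddTime → 𝕜)}

/-- The function `f` has the partial derivative `f'` with respect to `t_n` at `t`. -/
def HasPd (n : OddTime) (f : (OddTime → 𝕜) → A) (f' : A) (t : OddTime → 𝕜) : Prop :=
  HasDerivAt (fun s => f (Function.update t n s)) f' (t n)

theorem HasPd.pd_eq [ContinuousAdd A] [T2Space A] {n : OddTime} {f : (OddTime → 𝕜) → A} {f' : A}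
    {t : OddTime → 𝕜} (h : HasPd n f f' t) : pd n f t = f' :=
  deriv_eq_of_hasDerivAt h

omit [ContinuousSMul 𝕜 A] in
theorem pd_congr (hD : OddOpen D) {f g : (OddTime → 𝕜) → A} (h : ∀ t ∈ D, f t = g t)
    (n : OddTime) : ∀ t ∈ D, pd n f t = pd n g t := by
  intro t ht
  have e : (fun s => f (Function.update t n s)) =ᶠ[𝓝 (t n)]
      fun s => g (Function.update t n s) :=
    (hD t ht n).mono fun s hs => h _ hs
  simp only [pd, deriv, e.fderiv_eq]

theorem HasPd.congr (hD : OddOpen D) {f g : (OddTime → 𝕜) → A} (h : ∀ t ∈ D, f t = g t)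
    {n : OddTime} {f' : A} {t : OddTime → 𝕜} (ht : t ∈ D) (hg : HasPd n g f' t) :
    HasPd n f f' t := by
  have e : (fun s => f (Function.update t n s)) =ᶠ[𝓝 (t n)]
      fun s => g (Function.update t n s) :=
    (hD t ht n).mono fun s hs => h _ hs
  exact (hasDerivAt_iff_hasFDerivAt.2
    ((hasDerivAt_iff_hasFDerivAt.1 hg).congr_of_eventuallyEq e))

/-- The functions `G w` are the iterated partial derivatives of `G []` on `D`, and their order is
immaterial. -/
structure IsJetFamily (D : Set (OddTime → 𝕜)) (G : List OddTime → (OddTime → 𝕜) → A) : Prop where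
  hasPd : ∀ w n, ∀ t ∈ D, HasPd n (G w) (G (n :: w) t) t
  symm : ∀ w m n, ∀ t ∈ D, G (m :: n :: w) t = G (n :: m :: w) t

theorem OddSmoothOn.isJetFamily {f : (OddTime → 𝕜) → A} (h : OddSmoothOn D f) :
    IsJetFamily D fun w => iterPd w f where
  hasPd w n t ht := hasFDerivAt_iff_hasDerivAt.1 (h.diff w n t ht).hasFDerivAt
  symm w m n t ht := h.symm w m n t ht

namespace IsJetFamily

variable {G G' : List OddTime → (OddTime → 𝕜) → A}

/-- A partial derivative at a point of `D` sees only nearby values on a coordinate line, and by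
`OddOpen` these belong to `D`. So agreement on `D` survives each further differentiation. -/
theorem iterPd_eq [ContinuousAdd A] [T2Space A] (hG : IsJetFamily D G) (hD : OddOpen D)
    (w : List OddTime) : ∀ t ∈ D, iterPd w (G []) t = G w t := by
  induction w with
  | nil => intro t _; rfl
  | cons n w ih =>
    intro t ht
    exact (pd_congr hD ih n t ht).trans (hG.hasPd w n t ht).pd_eq

theorem oddSmoothOn [ContinuousAdd A] [T2Space A] (hG : IsJetFamily D G) (hD : OddOpen D) :
    OddSmoothOn D (G []) where
  diff w n t ht :=
    ((hG.hasPd w n t ht).congr hD (hG.iterPd_eq hD w) ht).hasFDerivAt.differentiableAt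
  symm w m n t ht := by
    rw [hG.iterPd_eq hD _ t ht, hG.iterPd_eq hD _ t ht, hG.symm w m n t ht]

theorem add [ContinuousAdd A] (hG : IsJetFamily D G) (hG' : IsJetFamily D G') :
    IsJetFamily D fun w t => G w t + G' w t where
  hasPd w n t ht := hasDerivAt_add (hG.hasPd w n t ht) (hG'.hasPd w n t ht)
  symm w m n t ht := by rw [hG.symm w m n t ht, hG'.symm w m n t ht]

theorem clm_comp {A' : Type*} [AddCommGroup A'] [Module 𝕜 A'] [TopologicalSpace A']
    [ContinuousSMul 𝕜 A'] (hG : IsJetFamily D G) (g : A →L[𝕜] A') :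
    IsJetFamily D fun w t => g (G w t) where
  hasPd w n t ht := hasDerivAt_clm_comp g (hG.hasPd w n t ht)
  symm w m n t ht := by rw [hG.symm w m n t ht]

theorem const_smul [Module ℂ A] [SMulCommClass 𝕜 ℂ A] [ContinuousConstSMul ℂ A]
    (hG : IsJetFamily D G) (c : ℂ) : IsJetFamily D fun w t => c • G w t :=
  hG.clm_comp
    { toFun := fun x => c • x
      map_add' := smul_add c
      map_smul' := fun a x => (smul_comm a c x).symm
      cont := continuous_const_smul c }

end IsJetFamily

theorem OddSmoothOn.clm_comp {A' : Type*} [AddCommGroup A'] [Module 𝕜 A'] [TopologicalSpace A']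
    [ContinuousSMul 𝕜 A'] [ContinuousAdd A'] [T2Space A'] (hD : OddOpen D)
    {W : (OddTime → 𝕜) → A} (hW : OddSmoothOn D W) (g : A →L[𝕜] A') :
    OddSmoothOn D fun t => g (W t) :=
  (hW.isJetFamily.clm_comp g).oddSmoothOn hD

end PartialDerivatives

/-! ### Transfer of identities from an abstract algebra to functions. -/

section Representation

variable {T : Type*} {D : Set T} {A : Type*} [NonUnitalRing A] [Module ℂ A]
  {B : Type*} [NonUnitalRing B] [Module ℂ B]

/-- The function `g` represents the element `b` of a differential algebra on `D`. -/
def Represents (D : Set T) (ev : T → B →ₙₐ[ℂ] A) (g : T → A) (b : B) : Prop :=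
  ∀ t ∈ D, g t = ev t b

namespace Represents

variable {ev : T → B →ₙₐ[ℂ] A} {f g : T → A} {a b : B}

theorem add (hf : Represents D ev f a) (hg : Represents D ev g b) :
    Represents D ev (f + g) (a + b) := fun t ht => by simp [hf t ht, hg t ht]

theorem sub (hf : Represents D ev f a) (hg : Represents D ev g b) :
    Represents D ev (f - g) (a - b) := fun t ht => by simp [hf t ht, hg t ht]

theorem neg (hf : Represents D ev f a) :
    Represents D ev (-f) (-a) := fun t ht => by simp [hf t ht]

theorem mul (hf : Represents D ev f a) (hg : Represents D ev g b) :
    Represents D ev (f * g) (a * b) := fun t ht => by simp [hf t ht, hg t ht]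

theorem smul (c : ℂ) (hf : Represents D ev f a) :
    Represents D ev (c • f) (c • a) := fun t ht => by simp [hf t ht]

theorem com (hf : Represents D ev f a) (hg : Represents D ev g b) :
    Represents D ev (com f g) (com a b) := (hf.mul hg).sub (hg.mul hf)

theorem acom (hf : Represents D ev f a) (hg : Represents D ev g b) :
    Represents D ev (acom f g) (acom a b) := (hf.mul hg).add (hg.mul hf)

theorem eq_zero (hf : Represents D ev f a) (ha : a = 0) {t : T} (ht : t ∈ D) : f t = 0 := by
  rw [hf t ht, ha, map_zero]

end Represents

/-- Both sides are homomorphisms on a free algebra and agree on its generators. -/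
theorem eval_comp [IsScalarTower ℂ A A] [SMulCommClass ℂ A A]
    [IsScalarTower ℂ B B] [SMulCommClass ℂ B B] (f : B →ₙₐ[ℂ] A)
    (x : JetSymbol → B) (P : OddDiffPoly) :
    f (OddDiffPoly.eval x P) = OddDiffPoly.eval (fun s => f (x s)) P := by
  have : f.comp (OddDiffPoly.eval x) = OddDiffPoly.eval fun s => f (x s) := by
    apply MonoidAlgebra.nonUnitalAlgHom_ext'
    apply FreeSemigroup.hom_ext
    funext s
    simp [OddDiffPoly.eval]
  exact DFunLike.congr_fun this P

end Representation

/-! ### Realizations of differential algebras by functions of the odd variables. -/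

section Realization

variable {𝕜 : Type*} [RCLike 𝕜] {D : Set (OddTime → 𝕜)}
  {A : Type*} [NonUnitalRing A] [Module 𝕜 A] [TopologicalSpace A] [Module ℂ A]
  [ContinuousSMul 𝕜 A]
  {B : Type*} [NonUnitalRing B] [Module ℂ B]

/-- A realization of a differential algebra by functions on `D`: the homomorphisms `ev t` evaluate
its elements at the points, and turn the derivations into partial derivatives on `D`. -/
def IsRealization (D : Set (OddTime → 𝕜)) (d : ℕ+ → B →ₗ[ℂ] B)
    (ev : (OddTime → 𝕜) → B →ₙₐ[ℂ] A) : Prop :=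
  ∀ b (n : OddTime), ∀ t ∈ D, HasPd n (fun t => ev t b) (ev t (d n b)) t

variable {d : ℕ+ → B →ₗ[ℂ] B} {ev : (OddTime → 𝕜) → B →ₙₐ[ℂ] A}

theorem IsRealization.isJetFamily (hev : IsRealization D d ev)
    (hcomm : ∀ m n a, d m (d n a) = d n (d m a)) (b : B) :
    IsJetFamily D fun w t => ev t (w.foldr (fun n f => d n f) b) where
  hasPd _ n t ht := hev _ n t ht
  symm _ m n t _ := congrArg (ev t) (hcomm m n _)

namespace Represents

variable {f g : (OddTime → 𝕜) → A} {a b : B}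

theorem hasPd (hev : IsRealization D d ev) (hD : OddOpen D) (hf : Represents D ev f a)
    (n : OddTime) {t : OddTime → 𝕜} (ht : t ∈ D) : HasPd n f (ev t (d n a)) t :=
  (hev a n t ht).congr hD hf ht

theorem pd [ContinuousAdd A] [T2Space A] (hev : IsRealization D d ev) (hD : OddOpen D)
    (hf : Represents D ev f a) (n : OddTime) : Represents D ev (pd n f) (d n a) :=
  fun _ ht => (hf.hasPd hev hD n ht).pd_eq

end Represents

end Realization

/-! ### From a formal KP solution to the odd KP hierarchy and system. -/

section SolutionsFromRealizations

variable {𝕜 : Type*} [RCLike 𝕜] {D : Set (OddTime → 𝕜)}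
  {A : Type*} [NonUnitalRing A] [Module 𝕜 A] [TopologicalSpace A] [Module ℂ A]
  [ContinuousSMul 𝕜 A] [ContinuousAdd A] [SMulCommClass 𝕜 ℂ A] [ContinuousConstSMul ℂ A]

omit [Module ℂ A] [SMulCommClass 𝕜 ℂ A] [ContinuousConstSMul ℂ A] in
theorem HasPd.add {f g : (OddTime → 𝕜) → A} {f' g' : A} {n : OddTime} {t : OddTime → 𝕜}
    (hf : HasPd n f f' t) (hg : HasPd n g g' t) : HasPd n (f + g) (f' + g') t :=
  hasDerivAt_add hf hg

omit [ContinuousAdd A] in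
theorem HasPd.const_smul {f : (OddTime → 𝕜) → A} {f' : A} {n : OddTime} {t : OddTime → 𝕜}
    (c : ℂ) (hf : HasPd n f f' t) : HasPd n (c • f) (c • f') t :=
  hasDerivAt_clm_comp
    { toFun := fun x : A => c • x
      map_add' := smul_add c
      map_smul' := fun a x => (smul_comm a c x).symm
      cont := continuous_const_smul c } hf

theorem HasPd.sub {f g : (OddTime → 𝕜) → A} {f' g' : A} {n : OddTime} {t : OddTime → 𝕜}
    (hf : HasPd n f f' t) (hg : HasPd n g g' t) : HasPd n (f - g) (f' - g') t := by
  have := hf.add (hg.const_smul (-1 : ℂ))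
  simpa only [neg_smul, one_smul, ← sub_eq_add_neg] using this

variable [T2Space A] [IsScalarTower ℂ A A] [SMulCommClass ℂ A A]
  {B : Type*} [NonUnitalRing B] [Module ℂ B] [IsScalarTower ℂ B B] [SMulCommClass ℂ B B]
  {d : ℕ+ → B →ₗ[ℂ] B} {ev : (OddTime → 𝕜) → B →ₙₐ[ℂ] A} {φ h : B}
  {f θ W : (OddTime → 𝕜) → A}

omit [IsScalarTower ℂ A A] [SMulCommClass ℂ A A] [IsScalarTower ℂ B B] [SMulCommClass ℂ B B] in
theorem IsRealization.oddSmoothOn_sub (hev : IsRealization D d ev) (hD : OddOpen D)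
    (hcomm : ∀ m n a, d m (d n a) = d n (d m a)) (hθ : ∀ t, θ t + (1 / 2 : ℂ) • W t = ev t h)
    (hW : OddSmoothOn D W) : OddSmoothOn D θ := by
  obtain rfl : θ = fun t => ev t h + (-1 / 2 : ℂ) • W t := by
    funext t
    rw [← hθ t]
    module
  exact ((hev.isJetFamily hcomm h).add (hW.isJetFamily.const_smul (-1 / 2))).oddSmoothOn hD

/-- An odd equation vanishes on the formal jets in `B`, and `ev t` maps these to the jets of the
functions at `t`. Only the combination `θ + W / 2` must come from `B`; `W` itself need not. `B` lies
in `Type` because `IsOddKPEquation` quantifies over that universe. -/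
theorem IsRealization.solvesOddKP {B : Type} [NonUnitalRing B] [Module ℂ B] [IsScalarTower ℂ B B]
    [SMulCommClass ℂ B B] {d : ℕ+ → B →ₗ[ℂ] B} {ev : (OddTime → 𝕜) → B →ₙₐ[ℂ] A} {φ h : B}
    (hev : IsRealization D d ev) (hD : OddOpen D)
    (hs : IsKPSolution d φ h) (hf : ∀ t, f t = ev t φ)
    (hθ : ∀ t, θ t + (1 / 2 : ℂ) • W t = ev t h) (hW : OddSmoothOn D W)
    (hWt : ∀ t ∈ D, pd t1 W t = com f (pd t1 f) t) : SolvesOddKP D f θ W where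
  smooth_phi := by
    obtain rfl : f = fun t => ev t φ := funext hf
    exact (hev.isJetFamily hs.comm φ).oddSmoothOn hD
  smooth_theta := hev.oddSmoothOn_sub hD hs.comm hθ hW
  smooth_integral := hW
  integral := hWt
  equations P hP t ht := by
    obtain rfl : f = fun t => ev t φ := funext hf
    have e : θ + (1 / 2 : ℂ) • W = fun t => ev t h := funext hθ
    have := eval_comp (ev t) (formalJet d φ h) P
    rw [hP B d φ h hs, map_zero] at this
    rw [e, this]
    congr 1
    congr 1
    funext s
    cases s with
    | phi w => exact (hev.isJetFamily hs.comm φ).iterPd_eq hD w t ht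
    | theta w => exact (hev.isJetFamily hs.comm h).iterPd_eq hD w t ht

omit [IsScalarTower ℂ A A] [SMulCommClass ℂ A A] in
-- Neither `θ` nor `J` need be represented in `B`. The represented quantities are `θ_{t_1}` and
-- `θ_{t_3} + J`, and the terms of the system can be regrouped so that only these and their
-- derivatives occur.
theorem IsRealization.solvesOddKPSystem
    (hev : IsRealization D d ev) (hD : OddOpen D)
    (hs : IsKPSolution d φ h) (hf : ∀ t, f t = ev t φ)
    (hθ : ∀ t, θ t + (1 / 2 : ℂ) • W t = ev t h) (hW : OddSmoothOn D W)
    (hWt : ∀ t ∈ D, pd t1 W t = com f (pd t1 f) t) :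
    SolvesOddKPSystem D f θ (integral31 f W) := by
  have hθs := hev.oddSmoothOn_sub hD hs.comm hθ hW
  have hθj := hθs.isJetFamily
  have rf : Represents D ev f φ := fun t _ => hf t
  have p1 : ∀ {g b}, Represents D ev g b → Represents D ev (pd t1 g) (d 1 b) :=
    fun r => r.pd hev hD t1
  have p3 : ∀ {g b}, Represents D ev g b → Represents D ev (pd t3 g) (d 3 b) :=
    fun r => r.pd hev hD t3
  have p5 : ∀ {g b}, Represents D ev g b → Represents D ev (pd t5 g) (d 5 b) :=
    fun r => r.pd hev hD t5
  have hθn : ∀ n : OddTime, ∀ t ∈ D, pd n θ t + (1 / 2 : ℂ) • pd n W t = ev t (d n h) := by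
    intro n t ht
    have a := (hθj.hasPd [] n t ht).add ((hW.isJetFamily.hasPd [] n t ht).const_smul (1 / 2))
    have b := hev h n t ht
    rw [show (fun t => ev t h) = θ + (1 / 2 : ℂ) • W from (funext hθ).symm] at b
    exact a.pd_eq.symm.trans b.pd_eq
  have r1 : Represents D ev (pd t1 θ) (kappa d φ h 1) := by
    intro t ht
    have a := hθn t1 t ht
    have b : (com f (pd t1 f)) t = ev t (com φ (d 1 φ)) := rf.com (p1 rf) t ht
    rw [hWt t ht, b] at a
    rw [kappa, map_sub, map_smul, show ev t (d 1 h) = _ from a.symm, add_sub_cancel_right]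
  have r3 : Represents D ev (pd t3 θ + integral31 f W) (kappa d φ h 3) := by
    intro t ht
    have a := hθn t3 t ht
    have b : (com f (pd t3 f)) t = ev t (com φ (d 3 φ)) := rf.com (p3 rf) t ht
    rw [kappa, map_sub, map_smul, show ev t (d 3 h) = _ from a.symm, ← b]
    simp only [integral31, Pi.add_apply, Pi.smul_apply, Pi.sub_apply, smul_sub]
    abel
  have r13 : Represents D ev (pd t1 (pd t3 θ)) (d 3 (kappa d φ h 1)) := fun t ht =>
    (hθs.symm [] t1 t3 t ht).trans (p3 r1 t ht)
  -- The bracket contains `θ_{t_5}`, which is not represented; it becomes so only after the outer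
  -- derivative, as the `t_5`-derivative of `θ_{t_1}`.
  have r15 : ∀ {u v w x y z}, Represents D ev u x → Represents D ev v y → Represents D ev w z →
      Represents D ev (pd t1 ((9 : ℂ) • pd t5 θ - (5 : ℂ) • u + v + w))
        ((9 : ℂ) • d 5 (kappa d φ h 1) + d 1 (- (5 : ℂ) • x + y + z)) := by
    intro u v w x y z hu hv hw t ht
    have a : pd t1 (pd t5 θ) t = ev t (d 5 (kappa d φ h 1)) :=
      (hθs.symm [] t1 t5 t ht).trans (p5 r1 t ht)
    have b := ((((hθj.hasPd [t5] t1 t ht).const_smul 9).sub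
      ((hu.hasPd hev hD t1 ht).const_smul 5)).add (hv.hasPd hev hD t1 ht)).add
      (hw.hasPd hev hD t1 ht)
    refine b.pd_eq.trans ?_
    rw [show iterPd [t1, t5] θ t = _ from a]
    simp only [map_add, map_smul, neg_smul, map_neg]
    abel
  -- `J` is differentiated as the difference of the represented `θ_{t_3} + J` and the smooth
  -- `θ_{t_3}`.
  have hJ : ∀ n : OddTime, ∀ t ∈ D,
      HasPd n (integral31 f W) (ev t (d n (kappa d φ h 3)) - pd n (pd t3 θ) t) t := by
    intro n t ht
    have a := (r3.hasPd hev hD n ht).sub (hθj.hasPd [t3] n t ht)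
    rwa [show iterPd [t3] θ = pd t3 θ from rfl, add_sub_cancel_left] at a
  have r33 : Represents D ev (pd t3 (pd t3 θ) + pd t3 (integral31 f W))
      (d 3 (kappa d φ h 3)) := fun t ht => by
    rw [Pi.add_apply, (hJ t3 t ht).pd_eq]
    exact add_sub_cancel _ _
  refine ⟨fun t ht => ?_, fun t ht => ?_, fun t ht => ?_⟩
  · have e : ev t (com (d 3 φ) (d 1 φ)) = com (pd t3 f) (pd t1 f) t :=
      ((p3 rf).com (p1 rf) t ht).symm
    rw [(hJ t1 t ht).pd_eq, r13 t ht, hs.d_kappa 3 1, ← e, map_sub]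
    exact sub_sub_cancel _ _
  -- The same equation, with `J` collected next to `θ_{t_3}`.
  · have e : (pd t1 ((9 : ℂ) • pd t5 f - (5 : ℂ) • pd t1 (pd t1 (pd t3 f))
          + pd t1 (pd t1 (pd t1 (pd t1 (pd t1 f))))
          - (15 / 2 : ℂ) • acom (pd t1 f) (pd t3 f - pd t1 (pd t1 (pd t1 f)) - pd t1 f * pd t1 f)
          + (45 / 4 : ℂ) • (pd t1 (pd t1 f) * pd t1 (pd t1 f)
              - (4 : ℂ) • (pd t1 θ * pd t1 θ)))
        - (5 : ℂ) • pd t3 (pd t3 f)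
        + (15 : ℂ) • (com (pd t1 f) ((pd t3 θ + integral31 f W) - pd t1 (pd t1 (pd t1 θ)))
          + com (pd t1 θ) (pd t3 f + (1 / 2 : ℂ) • pd t1 (pd t1 (pd t1 f)))
          + (3 / 2 : ℂ) • com (pd t1 (pd t1 θ)) (pd t1 (pd t1 f)))) t = 0 := by
      refine Represents.eq_zero (D := D) (ev := ev) ?_ hs.odd_equation_phi ht
      repeat' first
        | exact rf
        | exact r1
        | exact r3
        | apply p1
        | apply p3
        | apply p5
        | apply Represents.smul
        | apply Represents.com
        | apply Represents.acom
        | apply Represents.neg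
        | apply Represents.add
        | apply Represents.sub
        | apply Represents.mul
    refine Eq.trans (congrFun ?_ t) e
    simp only [iterPd, List.foldr, com, mul_add, add_mul, mul_sub, sub_mul]
    module
  · have e : (pd t1 ((9 : ℂ) • pd t5 θ - (5 : ℂ) • pd t1 (pd t1 (pd t3 θ))
          + pd t1 (pd t1 (pd t1 (pd t1 (pd t1 θ))))
          + (15 / 2 : ℂ) • ( - acom (pd t3 f) (pd t1 θ) + acom (pd t1 (pd t1 (pd t1 θ))) (pd t1 f)
            + (1 / 2 : ℂ) • pd t1 (acom (pd t1 θ) (pd t1 (pd t1 f)))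
            + (6 : ℂ) • (pd t1 f * pd t1 θ * pd t1 f)
            + (1 / 6 : ℂ) • com (pd t3 f) (pd t1 (pd t1 f))
            + (1 / 6 : ℂ) • pd t1 (pd t1 (com (pd t1 f) (pd t1 (pd t1 f))))
            - (1 / 4 : ℂ) • com (pd t1 (pd t1 f)) (pd t1 (pd t1 (pd t1 f)))))
        - (5 : ℂ) • (pd t3 (pd t3 θ) + pd t3 (integral31 f W))
        - (15 / 2 : ℂ) • pd t3 (acom (pd t1 θ) (pd t1 f))
        + (15 : ℂ) • com (pd t1 θ)
            ((pd t3 θ + integral31 f W) + (1 / 2 : ℂ) • pd t1 (pd t1 (pd t1 θ)))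
        + (45 : ℂ) • com (pd t1 θ * pd t1 θ) (pd t1 f)
        + (15 : ℂ) • com (pd t1 (pd t1 f)) (com (pd t1 f) (pd t1 θ))
        + (15 / 2 : ℂ) • com (com (pd t1 θ) (pd t1 (pd t1 f))) (pd t1 f)
        + (25 / 4 : ℂ) • com (pd t1 (pd t1 (pd t3 f))) (pd t1 f)
        + (15 / 2 : ℂ) • com (pd t3 f - pd t1 (pd t1 (pd t1 f))) (pd t1 f * pd t1 f)
        + (45 / 4 : ℂ) • com (pd t1 f) (pd t1 (pd t1 f) * pd t1 (pd t1 f))) t = 0 := by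
      refine Represents.eq_zero (D := D) (ev := ev) ?_ hs.odd_equation_h ht
      repeat' first
        | exact rf
        | exact r1
        | exact r3
        | exact r13
        | exact r33
        | apply r15
        | apply p1
        | apply p3
        | apply p5
        | apply Represents.smul
        | apply Represents.com
        | apply Represents.acom
        | apply Represents.neg
        | apply Represents.add
        | apply Represents.sub
        | apply Represents.mul
    refine Eq.trans (congrFun ?_ t) e
    simp only [iterPd, List.foldr, com, mul_add, add_mul, mul_sub, sub_mul]
    module

end SolutionsFromRealizations

/-! ### Derivations acting entrywise on matrices. -/

section MatrixDerivations

variable {K : Type*} [CommRing K] [Algebra ℂ K] {l m n : Type*}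

/-- The entrywise action of a derivation on matrices. -/
def matDer (δ : Derivation ℂ K K) : Matrix m n K →ₗ[ℂ] Matrix m n K :=
  LinearMap.mapMatrix δ.toLinearMap

theorem matDer_apply (δ : Derivation ℂ K K) (a : Matrix m n K) (i : m) (j : n) :
    matDer δ a i j = δ (a i j) := rfl

theorem matDer_mul [Fintype m] (δ : Derivation ℂ K K) (a : Matrix l m K) (b : Matrix m n K) :
    matDer δ (a * b) = matDer δ a * b + a * matDer δ b := by
  ext i j
  rw [matDer_apply, Matrix.mul_apply, map_sum, Matrix.add_apply, Matrix.mul_apply,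
    Matrix.mul_apply, ← Finset.sum_add_distrib]
  refine Finset.sum_congr rfl fun x _ => ?_
  rw [Derivation.leibniz, matDer_apply, matDer_apply, smul_eq_mul, smul_eq_mul]
  ring

theorem matDer_map_algebraMap (δ : Derivation ℂ K K) (a : Matrix m n ℂ) :
    matDer δ (a.map (algebraMap ℂ K)) = 0 := by
  ext i j
  simp [matDer_apply]

theorem matDer_one [DecidableEq m] (δ : Derivation ℂ K K) : matDer δ (1 : Matrix m m K) = 0 := by
  ext i j
  by_cases h : i = j <;> simp [matDer_apply, one_apply, h]

theorem matDer_fromRows {m' : Type*} (δ : Derivation ℂ K K) (a : Matrix m n K)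
    (b : Matrix m' n K) : matDer δ (fromRows a b) = fromRows (matDer δ a) (matDer δ b) := by
  ext i j
  cases i <;> rfl

theorem matDer_fromCols {n' : Type*} (δ : Derivation ℂ K K) (a : Matrix m n K)
    (b : Matrix m n' K) : matDer δ (fromCols a b) = fromCols (matDer δ a) (matDer δ b) := by
  ext i j
  cases j <;> rfl

end MatrixDerivations

/-! ### Graphs of matrices and the projections attached to them. -/

section Grassmannian

variable {K : Type*} [CommRing K] {m n : Type*} [Fintype m] [Fintype n] [DecidableEq m]
  [DecidableEq n]

/-- The column of blocks `(1, X)`, whose image is the graph of `X`. -/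
def graphCol (X : Matrix m n K) : Matrix (n ⊕ m) n K := fromRows 1 X

/-- The row of blocks `(-X, 1)`, whose kernel is the graph of `X`. -/
def graphRow (X : Matrix m n K) : Matrix m (n ⊕ m) K := fromCols (-X) 1

variable (K m n) in
/-- The row of blocks `(1, 0)`. -/
def fstRow : Matrix n (n ⊕ m) K := fromCols 1 0

variable (K m n) in
/-- The row of blocks `(0, 1)`. -/
def sndRow : Matrix m (n ⊕ m) K := fromCols 0 1

variable (K m n) in
/-- The column of blocks `(0, 1)`. -/
def sndCol : Matrix (n ⊕ m) m K := fromRows 0 1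

theorem sndRow_mul_graphCol (X : Matrix m n K) : sndRow K m n * graphCol X = X := by
  simp [sndRow, graphCol, fromCols_mul_fromRows]

omit [DecidableEq n] in
theorem sndRow_mul_sndCol : sndRow K m n * sndCol K m n = 1 := by
  simp [sndRow, sndCol, fromCols_mul_fromRows]

omit [Fintype m] in
theorem graphRow_eq (X : Matrix m n K) : graphRow X = sndRow K m n - X * fstRow K m n := by
  simp only [graphRow, sndRow, fstRow, mul_fromCols]
  ext i j
  cases j <;> simp

/-- The two sides describe the projection onto the second summand along the graph of `X`: the
product kills the graph, and its complement maps onto the graph along the second summand. -/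
theorem sndCol_mul_graphRow (X : Matrix m n K) :
    sndCol K m n * graphRow X = 1 - graphCol X * fstRow K m n := by
  rw [eq_sub_iff_add_eq]
  simp only [graphRow, graphCol, sndCol, fstRow, fromRows_mul_fromCols]
  rw [fromBlocks_add, ← fromBlocks_one]
  simp

end Grassmannian

/-! ### Riccati flows as linear flows of graphs, and their Miwa shifts. -/

section RiccatiFlow

variable {K : Type*} [CommRing K] [Algebra ℂ K] {m n : Type*} [Fintype m] [Fintype n]
  [DecidableEq m] [DecidableEq n]

/-- The right hand side of a Riccati equation, `S + L X - X R - X Q X` for the matrix `G` with the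
blocks `R`, `Q`, `S`, `L`. -/
def riccatiField (G : Matrix (n ⊕ m) (n ⊕ m) K) (X : Matrix m n K) : Matrix m n K :=
  graphRow X * G * graphCol X

variable {H : Matrix (n ⊕ m) (n ⊕ m) K} {X : Matrix m n K} {δ : Derivation ℂ K K} {k : ℕ}

/-- The graph moves by `H ^ k`; the projection removes the part along the graph, so that the upper
block stays 1. -/
theorem matDer_graphCol (hX : matDer δ X = riccatiField (H ^ k) X) :
    matDer δ (graphCol X) = sndCol K m n * graphRow X * H ^ k * graphCol X := by
  rw [Matrix.mul_assoc, Matrix.mul_assoc, ← Matrix.mul_assoc (graphRow X), ← riccatiField, ← hX,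
    graphCol, matDer_fromRows, matDer_one, sndCol, fromRows_mul]
  simp

theorem matDer_graphRow (hX : matDer δ X = riccatiField (H ^ k) X) :
    matDer δ (graphRow X) = - (graphRow X * H ^ k * graphCol X * fstRow K m n) := by
  rw [← riccatiField, ← hX, graphRow, matDer_fromCols, matDer_one, fstRow, mul_fromCols]
  ext i j
  cases j <;> simp

omit [Fintype m] [Fintype n] [DecidableEq n] in
theorem matDer_sndRow (δ : Derivation ℂ K K) : matDer δ (sndRow K m n) = 0 := by
  ext i j
  cases j <;> simp [matDer_apply, sndRow, one_apply, apply_ite]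

omit [Fintype m] [Fintype n] [DecidableEq n] in
theorem matDer_sndCol (δ : Derivation ℂ K K) : matDer δ (sndCol K m n) = 0 := by
  ext i j
  cases i <;> simp [matDer_apply, sndCol, one_apply, apply_ite]

theorem matDer_pow (hH : matDer δ H = 0) (k : ℕ) : matDer δ (H ^ k) = 0 := by
  induction k with
  | zero => rw [pow_zero, matDer_one]
  | succ k ih => rw [pow_succ, matDer_mul, ih, hH, Matrix.zero_mul, Matrix.mul_zero, add_zero]

theorem matDer_riccatiField (hH : matDer δ H = 0) (hX : matDer δ X = riccatiField (H ^ k) X)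
    (l : ℕ) : matDer δ (riccatiField (H ^ l) X) = riccatiField (H ^ (k + l)) X
      - riccatiField (H ^ k) X * fstRow K m n * H ^ l * graphCol X
      - riccatiField (H ^ l) X * fstRow K m n * H ^ k * graphCol X := by
  simp only [riccatiField, matDer_mul, matDer_pow hH, matDer_graphRow hX, matDer_graphCol hX,
    sndCol_mul_graphRow]
  simp only [Matrix.mul_zero, add_zero, Matrix.sub_mul, Matrix.mul_sub, Matrix.neg_mul,
    Matrix.one_mul, Matrix.mul_assoc, pow_add, (Commute.pow_pow (Commute.refl H) k l).eq]
  abel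

/-- By `matDer_riccatiField`, the second derivative of `X` is symmetric in the two exponents. -/
theorem matDer_comm {δ' : Derivation ℂ K K} {l : ℕ} (hH : matDer δ H = 0) (hH' : matDer δ' H = 0)
    (hX : matDer δ X = riccatiField (H ^ k) X) (hX' : matDer δ' X = riccatiField (H ^ l) X) :
    matDer δ (matDer δ' X) = matDer δ' (matDer δ X) := by
  rw [hX, hX', matDer_riccatiField hH hX, matDer_riccatiField hH' hX', add_comm k l]
  abel

/-- The coefficients of the Miwa shift of `graphCol X`, up to a right factor that depends on the
shift parameter. -/
def miwaCol (H : Matrix (n ⊕ m) (n ⊕ m) K) (X : Matrix m n K) (k : ℕ) : Matrix (n ⊕ m) n K :=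
  (sndCol K m n * graphRow X * H) ^ k * graphCol X

omit [Algebra ℂ K] in
theorem miwaCol_zero : miwaCol H X 0 = graphCol X := by
  rw [miwaCol, pow_zero, Matrix.one_mul]

omit [Algebra ℂ K] in
theorem miwaCol_succ (k : ℕ) :
    miwaCol H X (k + 1) = sndCol K m n * graphRow X * H * miwaCol H X k := by
  rw [miwaCol, pow_succ', Matrix.mul_assoc, miwaCol]

theorem matDer_sndCol_mul_graphRow (hX : matDer δ X = riccatiField (H ^ k) X) :
    matDer δ (sndCol K m n * graphRow X)
      = - (sndCol K m n * graphRow X * H ^ k * (1 - sndCol K m n * graphRow X)) := by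
  rw [matDer_mul, matDer_sndCol, matDer_graphRow hX, sndCol_mul_graphRow X, sub_sub_cancel,
    ← sndCol_mul_graphRow]
  simp only [Matrix.zero_mul, zero_add, Matrix.mul_neg, Matrix.mul_assoc]

theorem matDer_miwaCol_succ (hH : matDer δ H = 0) (hX : matDer δ X = riccatiField (H ^ k) X)
    (i : ℕ) : matDer δ (miwaCol H X (i + 1)) =
      sndCol K m n * graphRow X * H * matDer δ (miwaCol H X i)
      - sndCol K m n * graphRow X * (H ^ (k + 1) * miwaCol H X i
        - H ^ k * miwaCol H X (i + 1)) := by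
  rw [miwaCol_succ, matDer_mul, matDer_mul, hH, matDer_sndCol_mul_graphRow hX]
  generalize sndCol K m n * graphRow X = P
  simp only [Matrix.mul_zero, add_zero, Matrix.sub_mul, Matrix.mul_sub,
    Matrix.neg_mul, Matrix.mul_one, Matrix.mul_assoc, pow_succ]
  abel

/-- This is the recursion that defines `miwa`, so the powers of the projected `H` give the Miwa
coefficients. By `matDer_miwaCol_succ` the sum over the flows telescopes, apart from a multiple
supplied by the induction hypothesis. -/
theorem sum_matDer_miwaCol {D : ℕ → Derivation ℂ K K} (hH : ∀ k, matDer (D k) H = 0)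
    (hX : ∀ k, 1 ≤ k → matDer (D k) X = riccatiField (H ^ k) X) (k : ℕ) :
    ∑ j ∈ Finset.range (k + 1), matDer (D (j + 1)) (miwaCol H X (k - j))
      = ((k : ℂ) + 1) • miwaCol H X (k + 1) := by
  induction k with
  | zero =>
    simp only [zero_add, Finset.range_one, Finset.sum_singleton, Nat.sub_zero, Nat.cast_zero,
      one_smul, miwaCol_succ, miwaCol_zero, matDer_graphCol (hX 1 le_rfl), pow_one]
  | succ k ih =>
    rw [Finset.sum_range_succ, Nat.sub_self, miwaCol_zero, matDer_graphCol (hX _ (by omega))]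
    have e : ∀ j ∈ Finset.range (k + 1), matDer (D (j + 1)) (miwaCol H X (k + 1 - j)) =
        sndCol K m n * graphRow X * H * matDer (D (j + 1)) (miwaCol H X (k - j))
        - sndCol K m n * graphRow X * (H ^ (j + 1 + 1) * miwaCol H X (k + 1 - (j + 1))
          - H ^ (j + 1) * miwaCol H X (k + 1 - j)) := by
      intro j hj
      have hj' : j ≤ k := Nat.lt_succ_iff.1 (Finset.mem_range.1 hj)
      rw [show k + 1 - j = k - j + 1 by omega, matDer_miwaCol_succ (hH _) (hX _ (by omega)),
        show k + 1 - (j + 1) = k - j by omega]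
    rw [Finset.sum_congr rfl e, Finset.sum_sub_distrib, ← Matrix.mul_sum, ← Matrix.mul_sum, ih,
      Finset.sum_range_sub (fun j => H ^ (j + 1) * miwaCol H X (k + 1 - j)), Matrix.mul_smul,
      ← miwaCol_succ, Nat.sub_self, miwaCol_zero, Nat.sub_zero, zero_add, pow_one, Matrix.mul_sub,
      ← Matrix.mul_assoc _ H, ← miwaCol_succ, Matrix.mul_assoc _ (H ^ _)]
    push_cast
    module

/-- The shifted column `C` obeys the same flow as the unshifted one, `H C` corrected by `C (fstRow H
C)`; the sum is the convolution of that correction in powers of the shift parameter. -/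
theorem matDer_miwaCol_one (hH : matDer δ H = 0) (hX : matDer δ X = riccatiField H X) (k : ℕ) :
    matDer δ (miwaCol H X k) = H * miwaCol H X k
      - ∑ i ∈ Finset.range (k + 1), miwaCol H X i * (fstRow K m n * H * miwaCol H X (k - i)) := by
  have hX' : matDer δ X = riccatiField (H ^ 1) X := by rw [pow_one, hX]
  induction k with
  | zero =>
    simp only [zero_add, Finset.range_one, Finset.sum_singleton, Nat.sub_zero, miwaCol_zero,
      matDer_graphCol hX', sndCol_mul_graphRow, pow_one, Matrix.sub_mul, Matrix.one_mul,
      Matrix.mul_assoc]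
  | succ k ih =>
    rw [matDer_miwaCol_succ hH hX', ih, Finset.sum_range_succ' _ (k + 1), Nat.sub_zero,
      miwaCol_zero]
    have e : ∀ i ∈ Finset.range (k + 1),
        miwaCol H X (i + 1) * (fstRow K m n * H * miwaCol H X (k + 1 - (i + 1))) =
        sndCol K m n * graphRow X * H *
          (miwaCol H X i * (fstRow K m n * H * miwaCol H X (k - i))) := fun i _ => by
      rw [miwaCol_succ, Nat.add_sub_add_right, Matrix.mul_assoc]
    rw [Finset.sum_congr rfl e, ← Matrix.mul_sum]
    -- The summand `i = 0`, which the induction hypothesis does not cover, is rewritten by the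
    -- complementary projections.
    have e' : graphCol X * (fstRow K m n * H * miwaCol H X (k + 1)) =
        H * miwaCol H X (k + 1) - sndCol K m n * graphRow X * (H * miwaCol H X (k + 1)) := by
      rw [sndCol_mul_graphRow, Matrix.sub_mul, Matrix.one_mul, sub_sub_cancel, Matrix.mul_assoc,
        Matrix.mul_assoc]
    rw [e']
    generalize sndCol K m n * graphRow X = P
    generalize (∑ i ∈ Finset.range (k + 1), _ : Matrix (n ⊕ m) n K) = s
    simp only [Matrix.mul_sub, Matrix.mul_assoc, pow_succ, pow_zero, Matrix.one_mul]
    abel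

/-- The coefficients of the Miwa shift of `X`. -/
def miwaMat (H : Matrix (n ⊕ m) (n ⊕ m) K) (X : Matrix m n K) (k : ℕ) : Matrix m n K :=
  sndRow K m n * miwaCol H X k

omit [Algebra ℂ K] in
theorem miwaMat_zero : miwaMat H X 0 = X := by
  rw [miwaMat, miwaCol_zero, sndRow_mul_graphCol]

omit [Algebra ℂ K] in
theorem miwaMat_succ (k : ℕ) : miwaMat H X (k + 1) = graphRow X * H * miwaCol H X k := by
  rw [miwaMat, miwaCol_succ, Matrix.mul_assoc (sndCol K m n), Matrix.mul_assoc (sndCol K m n),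
    ← Matrix.mul_assoc (sndRow K m n), sndRow_mul_sndCol, Matrix.one_mul]

omit [Algebra ℂ K] in
theorem miwaCol_eq (hk : 1 ≤ k) : miwaCol H X k = sndCol K m n * miwaMat H X k := by
  obtain ⟨k, rfl⟩ := Nat.exists_eq_add_of_le' hk
  rw [miwaMat_succ, miwaCol_succ]
  simp only [Matrix.mul_assoc]

theorem sum_matDer_miwaMat {D : ℕ → Derivation ℂ K K} (hH : ∀ k, matDer (D k) H = 0)
    (hX : ∀ k, 1 ≤ k → matDer (D k) X = riccatiField (H ^ k) X) (k : ℕ) :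
    ∑ j ∈ Finset.range (k + 1), matDer (D (j + 1)) (miwaMat H X (k - j))
      = ((k : ℂ) + 1) • miwaMat H X (k + 1) := by
  simp only [miwaMat, matDer_mul, matDer_sndRow, Matrix.zero_mul, zero_add]
  rw [← Matrix.mul_sum, sum_matDer_miwaCol hH hX, Matrix.mul_smul]

section Blocks

variable {R : Matrix n n K} {Q : Matrix n m K} {S : Matrix m n K} {L : Matrix m m K}

omit [Algebra ℂ K] [DecidableEq m] in
theorem fstRow_mul_fromBlocks :
    fstRow K m n * fromBlocks R Q S L = fromCols R Q := by
  simp [fstRow, fromCols_mul_fromBlocks]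

omit [Algebra ℂ K] [DecidableEq n] in
theorem sndRow_mul_fromBlocks :
    sndRow K m n * fromBlocks R Q S L = fromCols S L := by
  simp [sndRow, fromCols_mul_fromBlocks]

omit [Algebra ℂ K] in
theorem riccatiField_fromBlocks :
    riccatiField (fromBlocks R Q S L) X = S + L * X - X * R - X * Q * X := by
  rw [riccatiField, graphRow_eq, Matrix.sub_mul, sndRow_mul_fromBlocks, Matrix.mul_assoc,
    fstRow_mul_fromBlocks, Matrix.sub_mul, Matrix.mul_assoc, graphCol, fromCols_mul_fromRows,
    fromCols_mul_fromRows]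
  simp only [Matrix.mul_one, Matrix.mul_add, Matrix.mul_assoc]
  abel

theorem miwaMat_succ_eq (hk : 1 ≤ k) : miwaMat (fromBlocks R Q S L) X (k + 1) =
    L * miwaMat (fromBlocks R Q S L) X k - X * Q * miwaMat (fromBlocks R Q S L) X k := by
  rw [miwaMat_succ, miwaCol_eq hk, graphRow_eq, Matrix.sub_mul, sndRow_mul_fromBlocks,
    Matrix.mul_assoc X, fstRow_mul_fromBlocks, Matrix.sub_mul, Matrix.mul_assoc X,
    ← Matrix.mul_assoc, ← Matrix.mul_assoc _ (sndCol K m n), sndCol, fromCols_mul_fromRows,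
    fromCols_mul_fromRows]
  simp only [Matrix.mul_zero, Matrix.mul_one, zero_add, Matrix.mul_assoc]

/-- The shifted matrix satisfies the first Riccati equation again; this is its coefficient of order
`k`, with the two quadratic terms containing `y 0 = X` written separately. -/
theorem matDer_miwaMat (hH : matDer δ (fromBlocks R Q S L) = 0)
    (hX : matDer δ X = riccatiField (fromBlocks R Q S L) X) {y : ℕ → Matrix m n K}
    (hy : ∀ k, y k = miwaMat (fromBlocks R Q S L) X k) (hk : 1 ≤ k) :
    matDer δ (y k) = L * y k - X * Q * y k - ∑ i ∈ Finset.Ico 1 k, y i * Q * y (k - i)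
      - y k * Q * X - y k * R := by
  have e : ∀ j, 1 ≤ j → fstRow K m n * fromBlocks R Q S L * miwaCol (fromBlocks R Q S L) X j =
      Q * y j := fun j hj => by
    rw [miwaCol_eq hj, fstRow_mul_fromBlocks, ← Matrix.mul_assoc, sndCol, fromCols_mul_fromRows,
      Matrix.mul_zero, Matrix.mul_one, zero_add, hy]
  have e0 : fstRow K m n * fromBlocks R Q S L * miwaCol (fromBlocks R Q S L) X 0 =
      R + Q * X := by
    rw [miwaCol_zero, fstRow_mul_fromBlocks, graphCol, fromCols_mul_fromRows, Matrix.mul_one]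
  have e' : sndRow K m n * (fromBlocks R Q S L * miwaCol (fromBlocks R Q S L) X k) = L * y k := by
    rw [miwaCol_eq hk, ← Matrix.mul_assoc, sndRow_mul_fromBlocks, ← Matrix.mul_assoc, sndCol,
      fromCols_mul_fromRows, Matrix.mul_zero, Matrix.mul_one, zero_add, hy]
  -- The summand `i = k` is split off because its right factor is the unshifted column, whose upper
  -- block is 1: it yields the term with `R`.
  rw [hy k, miwaMat, matDer_mul, matDer_sndRow, Matrix.zero_mul, zero_add,
    matDer_miwaCol_one hH hX, Matrix.mul_sub, e', Matrix.mul_sum, Finset.sum_range_succ,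
    Nat.sub_self, e0, ← Nat.Ico_zero_eq_range, Finset.sum_eq_sum_Ico_succ_bot (by omega)]
  have hy' : ∀ i, sndRow K m n * miwaCol (fromBlocks R Q S L) X i = y i := fun i => (hy i).symm
  simp only [← Matrix.mul_assoc (sndRow K m n), hy']
  have es : ∀ i ∈ Finset.Ico (0 + 1) k,
      y i * (fstRow K m n * fromBlocks R Q S L * miwaCol (fromBlocks R Q S L) X (k - i)) =
      y i * Q * y (k - i) := fun i hi => by
    rw [e _ (by have := (Finset.mem_Ico.1 hi).2; omega), Matrix.mul_assoc]
  rw [Finset.sum_congr rfl es, Nat.sub_zero, e k hk, hy 0, miwaMat_zero]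
  simp only [zero_add, Matrix.mul_add, Matrix.mul_assoc]
  abel

end Blocks

end RiccatiFlow

/-! ### The universal Riccati hierarchy on polynomial matrices solves KP. -/

section PolynomialMatrices

variable {M N : ℕ}

/-- The polynomials in the entries of an `M × N` matrix. -/
abbrev EntryPoly (M N : ℕ) : Type := MvPolynomial (Fin M × Fin N) ℂ

/-- The `M × N` matrices of polynomials in the entries of an `M × N` matrix, with the product
`X ∘ Y = X * Q * Y`. -/
def PolyMat (_Q : Matrix (Fin N) (Fin M) ℂ) : Type :=
  Matrix (Fin M) (Fin N) (EntryPoly M N)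

/-- A complex matrix, regarded as a matrix of constant polynomials. -/
noncomputable abbrev constMat (M N : ℕ) {m n : Type*} (a : Matrix m n ℂ) :
    Matrix m n (EntryPoly M N) :=
  a.map (algebraMap ℂ (EntryPoly M N))

namespace PolyMat

variable (Q : Matrix (Fin N) (Fin M) ℂ)

noncomputable instance : NonUnitalRing (PolyMat Q) :=
  { (inferInstance : AddCommGroup (Matrix (Fin M) (Fin N) (EntryPoly M N))) with
    mul := fun (X Y : Matrix (Fin M) (Fin N) (EntryPoly M N)) => X * constMat M N Q * Y
    left_distrib := fun (X Y Z : Matrix (Fin M) (Fin N) (EntryPoly M N)) =>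
      Matrix.mul_add (X * constMat M N Q) Y Z
    right_distrib := fun (X Y Z : Matrix (Fin M) (Fin N) (EntryPoly M N)) => by
      change (X + Y) * constMat M N Q * Z = X * constMat M N Q * Z + Y * constMat M N Q * Z
      rw [Matrix.add_mul, Matrix.add_mul]
    zero_mul := fun (X : Matrix (Fin M) (Fin N) (EntryPoly M N)) => by
      change (0 : Matrix (Fin M) (Fin N) (EntryPoly M N)) * constMat M N Q * X = 0
      rw [Matrix.zero_mul, Matrix.zero_mul]
    mul_zero := fun (X : Matrix (Fin M) (Fin N) (EntryPoly M N)) =>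
      Matrix.mul_zero (X * constMat M N Q)
    mul_assoc := fun (X Y Z : Matrix (Fin M) (Fin N) (EntryPoly M N)) => by
      change X * constMat M N Q * Y * constMat M N Q * Z =
        X * constMat M N Q * (Y * constMat M N Q * Z)
      simp only [Matrix.mul_assoc] }

noncomputable instance : Module ℂ (PolyMat Q) :=
  (inferInstance : Module ℂ (Matrix (Fin M) (Fin N) (EntryPoly M N)))

instance : IsScalarTower ℂ (PolyMat Q) (PolyMat Q) where
  smul_assoc := fun c (X Y : Matrix (Fin M) (Fin N) (EntryPoly M N)) => by
    change (c • X) * constMat M N Q * Y = c • (X * constMat M N Q * Y)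
    rw [Matrix.smul_mul, Matrix.smul_mul]

instance : SMulCommClass ℂ (PolyMat Q) (PolyMat Q) where
  smul_comm := fun c (X Y : Matrix (Fin M) (Fin N) (EntryPoly M N)) => by
    change c • (X * constMat M N Q * Y) = X * constMat M N Q * (c • Y)
    rw [Matrix.mul_smul]

end PolyMat

/-- The matrix whose entries are the indeterminates. -/
noncomputable def genericMat (M N : ℕ) :
    Matrix (Fin M) (Fin N) (EntryPoly M N) :=
  Matrix.of fun i j => MvPolynomial.X (i, j)

/-- The polynomial vector field of the `k`-th Riccati equation. -/
noncomputable def riccatiDer (H : Matrix (Fin N ⊕ Fin M) (Fin N ⊕ Fin M) ℂ) (k : ℕ) :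
    Derivation ℂ (EntryPoly M N) (EntryPoly M N) :=
  MvPolynomial.mkDerivation ℂ fun p =>
    riccatiField (constMat M N H ^ k) (genericMat M N) p.1 p.2

variable (H : Matrix (Fin N ⊕ Fin M) (Fin N ⊕ Fin M) ℂ)

theorem matDer_riccatiDer_genericMat (k : ℕ) :
    matDer (riccatiDer H k) (genericMat M N) =
      riccatiField (constMat M N H ^ k) (genericMat M N) := by
  ext1 i j
  rw [matDer_apply, genericMat, of_apply, riccatiDer, MvPolynomial.mkDerivation_X]
  rfl

/-- The commutator of two derivations is a derivation, hence determined by the indeterminates, where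
`matDer_comm` applies. -/
theorem riccatiDer_comm (k l : ℕ) (p : EntryPoly M N) :
    riccatiDer H k (riccatiDer H l p) = riccatiDer H l (riccatiDer H k p) := by
  have e : ⁅riccatiDer H k, riccatiDer H l⁆ = (0 : Derivation ℂ _ _) := by
    refine MvPolynomial.derivation_ext fun i => ?_
    rw [Derivation.commutator_apply, Derivation.zero_apply, sub_eq_zero]
    have := matDer_comm (matDer_map_algebraMap (riccatiDer H k) H)
      (matDer_map_algebraMap (riccatiDer H l) H) (matDer_riccatiDer_genericMat H k)
      (matDer_riccatiDer_genericMat H l)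
    exact congrFun (congrFun this i.1) i.2
  have := DFunLike.congr_fun e p
  rwa [Derivation.commutator_apply, Derivation.zero_apply, sub_eq_zero] at this

variable (R : Matrix (Fin N) (Fin N) ℂ) (Q : Matrix (Fin N) (Fin M) ℂ)
  (S : Matrix (Fin M) (Fin N) ℂ) (L : Matrix (Fin M) (Fin M) ℂ)

/-- The derivations of the Riccati hierarchy. -/
noncomputable def PolyMat.der (k : ℕ+) : PolyMat Q →ₗ[ℂ] PolyMat Q :=
  matDer (m := Fin M) (n := Fin N) (riccatiDer (fromBlocks R Q S L) k)

/-- The dependent variable `φ` of the KP hierarchy: the generic matrix `X`. -/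
noncomputable def PolyMat.phi : PolyMat Q := genericMat M N

/-- The dependent variable `θ` of the KP hierarchy, in terms of the generic matrix `X`. -/
noncomputable def PolyMat.theta : PolyMat Q :=
  ((1 / 2 : ℂ) • (constMat M N L * genericMat M N + genericMat M N * constMat M N R) :
    Matrix (Fin M) (Fin N) (EntryPoly M N))

/-- Needed because multiplication by the constants `L` and `R` is a linear map commuting with the
derivations, but not multiplication by an element of `PolyMat Q`. -/
theorem PolyMat.miwa_linear {a : PolyMat Q} (f : PolyMat Q →ₗ[ℂ] PolyMat Q)
    (hf : ∀ k x, PolyMat.der R Q S L k (f x) = f (PolyMat.der R Q S L k x)) (k : ℕ) :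
    miwa (PolyMat.der R Q S L) (f a) k = f (miwa (PolyMat.der R Q S L) a k) := by
  induction k using Nat.strong_induction_on with
  | _ k ih =>
    cases k with
    | zero => rw [miwa, miwa]
    | succ k =>
      rw [miwa, miwa, map_smul, map_sum]
      congr 1
      refine Finset.sum_congr rfl fun j _ => ?_
      rw [ih _ (by omega), hf]

theorem PolyMat.miwa_phi (k : ℕ) : miwa (PolyMat.der R Q S L) (PolyMat.phi Q) k =
    miwaMat (constMat M N (fromBlocks R Q S L)) (genericMat M N) k := by
  induction k using Nat.strong_induction_on with
  | _ k ih =>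
    cases k with
    | zero => rw [miwa, miwaMat_zero]; rfl
    | succ k =>
      have e := sum_matDer_miwaMat
        (fun k => matDer_map_algebraMap (riccatiDer (fromBlocks R Q S L) k) (fromBlocks R Q S L))
        (fun k _ => matDer_riccatiDer_genericMat (fromBlocks R Q S L) k) k
      rw [miwa]
      have e' : ∀ j : Fin (k + 1), PolyMat.der R Q S L (Nat.succPNat j)
          (miwa (PolyMat.der R Q S L) (PolyMat.phi Q) (k - j)) =
          matDer (riccatiDer (fromBlocks R Q S L) ((j : ℕ) + 1))
            (miwaMat (constMat M N (fromBlocks R Q S L)) (genericMat M N) (k - j)) := fun j => by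
        rw [ih _ (by omega)]
        rfl
      rw [Finset.sum_congr rfl fun j _ => e' j]
      refine (congrArg (((k : ℂ) + 1)⁻¹ • ·) ((Fin.sum_univ_eq_sum_range (fun j =>
        matDer (riccatiDer (fromBlocks R Q S L) (j + 1))
            (miwaMat (constMat M N (fromBlocks R Q S L)) (genericMat M N) (k - j))) (k + 1)).trans
              e)).trans ?_
      exact inv_smul_smul₀ (Nat.cast_add_one_ne_zero k) _

/-- Left multiplication by `L` plus right multiplication by `R`, halved. -/
noncomputable def PolyMat.halfSum : PolyMat Q →ₗ[ℂ] PolyMat Q where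
  toFun (a : Matrix (Fin M) (Fin N) (EntryPoly M N)) :=
    ((1 / 2 : ℂ) • (constMat M N L * a + a * constMat M N R) :
      Matrix (Fin M) (Fin N) (EntryPoly M N))
  map_add' (a b : Matrix (Fin M) (Fin N) (EntryPoly M N)) := by
    change (1 / 2 : ℂ) • (constMat M N L * (a + b) + (a + b) * constMat M N R) =
      (1 / 2 : ℂ) • (constMat M N L * a + a * constMat M N R) +
      (1 / 2 : ℂ) • (constMat M N L * b + b * constMat M N R)
    rw [Matrix.mul_add, Matrix.add_mul]
    module
  map_smul' c (a : Matrix (Fin M) (Fin N) (EntryPoly M N)) := by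
    change (1 / 2 : ℂ) • (constMat M N L * (c • a) + (c • a) * constMat M N R) =
      c • (1 / 2 : ℂ) • (constMat M N L * a + a * constMat M N R)
    rw [Matrix.mul_smul, Matrix.smul_mul]
    module

theorem PolyMat.miwa_theta (k : ℕ) : miwa (PolyMat.der R Q S L) (PolyMat.theta R Q L) k =
    PolyMat.halfSum R Q L (miwa (PolyMat.der R Q S L) (PolyMat.phi Q) k) := by
  refine PolyMat.miwa_linear R Q S L (a := PolyMat.phi Q) (PolyMat.halfSum R Q L)
    (fun k (x : Matrix (Fin M) (Fin N) (EntryPoly M N)) => ?_) k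
  change matDer _ ((1 / 2 : ℂ) • (constMat M N L * x + x * constMat M N R)) =
    (1 / 2 : ℂ) • (constMat M N L * matDer _ x + matDer _ x * constMat M N R)
  rw [map_smul, map_add, matDer_mul, matDer_mul, matDer_map_algebraMap, matDer_map_algebraMap,
    Matrix.zero_mul, zero_add, Matrix.mul_zero, add_zero]

/-- In order `k`, substituting `matDer_miwaMat` for the `t_1`-derivative and `(L - X Q) y_k` for
`y_{k+1}` cancels all terms with `Q` and leaves `(L y_k + y_k R) / 2`. -/
theorem PolyMat.isKPSolution :
    IsKPSolution (PolyMat.der R Q S L) (PolyMat.phi Q) (PolyMat.theta R Q L) where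
  leibniz k (a b : Matrix (Fin M) (Fin N) (EntryPoly M N)) := by
    change matDer _ (a * constMat M N Q * b) =
      matDer _ a * constMat M N Q * b + a * constMat M N Q * matDer _ b
    rw [matDer_mul, matDer_mul, matDer_map_algebraMap, Matrix.mul_zero, add_zero]
  comm k l a := by
    refine Matrix.ext fun i j => ?_
    exact riccatiDer_comm _ _ _ _
  kp k hk := by
    rw [PolyMat.miwa_theta]
    simp only [PolyMat.miwa_phi]
    have eH : constMat M N (fromBlocks R Q S L) = fromBlocks (constMat M N R) (constMat M N Q)
      (constMat M N S) (constMat M N L) := fromBlocks_map _ _ _ _ _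
    set y := miwaMat (constMat M N (fromBlocks R Q S L)) (genericMat M N) with hy
    change y (k + 1) - (1 / 2 : ℂ) • matDer (riccatiDer (fromBlocks R Q S L) 1) (y k)
      - (1 / 2 : ℂ) • ∑ i ∈ Finset.Ico 1 k, y i * constMat M N Q * y (k - i)
      + (1 / 2 : ℂ) • (genericMat M N * constMat M N Q * y k
        - y k * constMat M N Q * genericMat M N)
      = (1 / 2 : ℂ) • (constMat M N L * y k + y k * constMat M N R)
    have h0 : matDer (riccatiDer (fromBlocks R Q S L) 1)
        (constMat M N (fromBlocks R Q S L)) = 0 :=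
      matDer_map_algebraMap _ _
    have h1 := matDer_riccatiDer_genericMat (fromBlocks R Q S L) 1
    rw [pow_one] at h1
    rw [eH] at h0 h1 hy
    have e1 := matDer_miwaMat h0 h1 (y := y) (fun k => congrFun hy k) hk
    have e2 : y (k + 1) = _ := (congrFun hy (k + 1)).trans (miwaMat_succ_eq hk)
    rw [← hy] at e2
    rw [e1, e2]
    module

end PolynomialMatrices

/-! ### Evaluation along a solution of the odd Riccati hierarchy. -/

section Evaluation

variable {M N : ℕ}

/-- Evaluation of polynomial matrices at a matrix. -/
noncomputable def PolyMat.evalAt (Q : Matrix (Fin N) (Fin M) ℂ) (X : Matrix (Fin M) (Fin N) ℂ) :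
    PolyMat Q →ₙₐ[ℂ] QMat Q where
  toFun (a : Matrix (Fin M) (Fin N) (EntryPoly M N)) :=
    (a.map (MvPolynomial.eval fun p => X p.1 p.2) : Matrix (Fin M) (Fin N) ℂ)
  map_smul' c (a : Matrix (Fin M) (Fin N) (EntryPoly M N)) := by
    change (c • a).map _ = c • a.map _
    exact Matrix.map_smul _ c (fun p => MvPolynomial.smul_eval _ p c) a
  map_zero' := by
    change (0 : Matrix (Fin M) (Fin N) (EntryPoly M N)).map _ = 0
    exact Matrix.map_zero _ (map_zero _)
  map_add' (a b : Matrix (Fin M) (Fin N) (EntryPoly M N)) := by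
    change (a + b).map _ = a.map _ + b.map _
    exact Matrix.map_add _ (map_add _) a b
  map_mul' (a b : Matrix (Fin M) (Fin N) (EntryPoly M N)) := by
    change (a * constMat M N Q * b).map (MvPolynomial.eval fun p => X p.1 p.2) =
      a.map (MvPolynomial.eval fun p => X p.1 p.2) * Q *
        b.map (MvPolynomial.eval fun p => X p.1 p.2)
    rw [Matrix.map_mul, Matrix.map_mul, Matrix.map_map]
    congr 2
    ext i j
    simp

theorem constMat_map_eval {m n : Type*} (a : Matrix m n ℂ) (x : Fin M × Fin N → ℂ) :
    (constMat M N a).map (MvPolynomial.eval x) = a := by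
  ext i j
  simp

theorem genericMat_map_eval (X : Matrix (Fin M) (Fin N) ℂ) :
    (genericMat M N).map (MvPolynomial.eval fun p => X p.1 p.2) = X := by
  ext i j
  simp [genericMat]

theorem PolyMat.evalAt_phi (Q : Matrix (Fin N) (Fin M) ℂ) (X : Matrix (Fin M) (Fin N) ℂ) :
    PolyMat.evalAt Q X (PolyMat.phi Q) = X := genericMat_map_eval X

theorem PolyMat.evalAt_theta (R : Matrix (Fin N) (Fin N) ℂ) (Q : Matrix (Fin N) (Fin M) ℂ)
    (L : Matrix (Fin M) (Fin M) ℂ) (X : Matrix (Fin M) (Fin N) ℂ) :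
    PolyMat.evalAt Q X (PolyMat.theta R Q L) = ((1 / 2 : ℂ) • (L * X + X * R) :
      Matrix (Fin M) (Fin N) ℂ) := by
  have e : (constMat M N L * genericMat M N + genericMat M N * constMat M N R).map
      (MvPolynomial.eval fun p => X p.1 p.2) = L * X + X * R := by
    rw [Matrix.map_add _ (map_add _), Matrix.map_mul, Matrix.map_mul, genericMat_map_eval,
      constMat_map_eval, constMat_map_eval]
  rw [← e]
  exact Matrix.map_smul _ _ (fun p => MvPolynomial.smul_eval _ p _) _

theorem riccatiField_map {K K' : Type*} [CommRing K] [CommRing K'] {m n : Type*} [Fintype m]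
    [Fintype n] [DecidableEq m] [DecidableEq n] (f : K →+* K') (G : Matrix (n ⊕ m) (n ⊕ m) K)
    (X : Matrix m n K) : (riccatiField G X).map f = riccatiField (G.map f) (X.map f) := by
  have e1 : (graphRow X).map f = graphRow (X.map f) := by
    ext i j
    cases j <;> simp [graphRow, one_apply, apply_ite f]
  have e2 : (graphCol X).map f = graphCol (X.map f) := by
    ext i j
    cases i <;> simp [graphCol, one_apply, apply_ite f]
  rw [riccatiField, Matrix.map_mul, Matrix.map_mul, e1, e2, riccatiField]

theorem riccatiField_pow_eq (H : Matrix (Fin N ⊕ Fin M) (Fin N ⊕ Fin M) ℂ) (k : ℕ)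
    (X : Matrix (Fin M) (Fin N) ℂ) : riccatiField (H ^ k) X = riccatiRHS H k X := by
  conv_lhs => rw [← fromBlocks_toBlocks (H ^ k)]
  exact riccatiField_fromBlocks

variable {𝕜 : Type*} [RCLike 𝕜] [NormedAlgebra 𝕜 ℂ]

/-- The chain rule: the derivation is the polynomial vector field of which the curve has the
velocity, so induction on the polynomial reduces to single entries. -/
theorem hasDerivAt_eval_of_riccati {H : Matrix (Fin N ⊕ Fin M) (Fin N ⊕ Fin M) ℂ} {k : ℕ}
    {γ : 𝕜 → Matrix (Fin M) (Fin N) ℂ} {s : 𝕜}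
    (hγ : HasDerivAt γ (riccatiRHS H k (γ s)) s) (p : EntryPoly M N) :
    HasDerivAt (fun s => MvPolynomial.eval (fun q => γ s q.1 q.2) p)
      (MvPolynomial.eval (fun q => γ s q.1 q.2) (riccatiDer H k p)) s := by
  induction p using MvPolynomial.induction_on with
  | C a => simpa using hasDerivAt_const s a
  | add p q hp hq =>
    simp only [map_add]
    exact hp.add hq
  | mul_X p q hp =>
    have e : MvPolynomial.eval (fun q => γ s q.1 q.2) (riccatiDer H k (MvPolynomial.X q)) =
        riccatiRHS H k (γ s) q.1 q.2 := by
      rw [riccatiDer, MvPolynomial.mkDerivation_X, ← riccatiField_pow_eq]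
      have := riccatiField_map (MvPolynomial.eval fun q => γ s q.1 q.2) (constMat M N H ^ k)
        (genericMat M N)
      rw [genericMat_map_eval, Matrix.map_pow, constMat_map_eval] at this
      exact congrFun (congrFun this q.1) q.2
    have hq : HasDerivAt (fun s => γ s q.1 q.2) (riccatiRHS H k (γ s) q.1 q.2) s :=
      hasDerivAt_clm_comp
        (⟨{ toFun := fun a => a q.1 q.2, map_add' := fun _ _ => rfl, map_smul' := fun _ _ => rfl },
          continuous_id.matrix_elem _ _⟩ : Matrix (Fin M) (Fin N) ℂ →L[𝕜] ℂ) hγ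
    simp only [map_mul, Derivation.leibniz, map_add, smul_eq_mul, MvPolynomial.eval_X, e]
    refine (hp.mul hq).congr_deriv ?_
    ring

/-- `ψ` and `g` are the same map, once as a homomorphism of algebras and once as a continuous linear
map. -/
theorem SolvesOddRiccati.isRealization {R : Matrix (Fin N) (Fin N) ℂ}
    {Q : Matrix (Fin N) (Fin M) ℂ} {S : Matrix (Fin M) (Fin N) ℂ} {L : Matrix (Fin M) (Fin M) ℂ}
    {D : Set (OddTime → 𝕜)} {Φ : (OddTime → 𝕜) → Matrix (Fin M) (Fin N) ℂ}
    (hΦ : SolvesOddRiccati (fromBlocks R Q S L) D Φ) {A : Type*} [NonUnitalRing A] [Module 𝕜 A]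
    [TopologicalSpace A] [Module ℂ A] [ContinuousSMul 𝕜 A] (ψ : QMat Q →ₙₐ[ℂ] A)
    (g : Matrix (Fin M) (Fin N) ℂ →L[𝕜] A) (hg : ∀ X, ψ X = g X) :
    IsRealization D (PolyMat.der R Q S L) fun t => ψ.comp (PolyMat.evalAt Q (Φ t)) := by
  intro b k t ht
  have h : HasDerivAt (fun s => (b : Matrix (Fin M) (Fin N) (EntryPoly M N)).map
      (MvPolynomial.eval fun p => Φ (Function.update t k s) p.1 p.2))
      ((matDer (riccatiDer (fromBlocks R Q S L) (k : ℕ+)) b).map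
        (MvPolynomial.eval fun p => Φ t p.1 p.2)) (t k) := by
    refine hasDerivAt_pi_of_forall fun i => hasDerivAt_pi_of_forall fun j => ?_
    have h' := hΦ k t ht
    rw [← Function.update_eq_self k t] at h'
    have := hasDerivAt_eval_of_riccati (γ := fun s => Φ (Function.update t k s)) (k := (k : ℕ+))
      (s := t k) (H := fromBlocks R Q S L) (by simpa using h') (b i j)
    rw [Function.update_eq_self] at this
    exact this
  have e (X : Matrix (Fin M) (Fin N) ℂ) (a : PolyMat Q) :
      ψ.comp (PolyMat.evalAt Q X) a = g (PolyMat.evalAt Q X a) := hg _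
  simp only [HasPd, e]
  exact hasDerivAt_clm_comp g h

end Evaluation

/-! ### The three target algebras and the final statement. -/

section MainResults

theorem com_eq_zero {X : Type*} [NonUnitalCommRing X] (a b : X) : com a b = 0 := by
  rw [com, mul_comm, sub_self]

instance {M N : ℕ} (Q : Matrix (Fin N) (Fin M) ℂ) : ContinuousAdd (QMat Q) :=
  inferInstanceAs (ContinuousAdd (Matrix (Fin M) (Fin N) ℂ))

instance {M N : ℕ} (Q : Matrix (Fin N) (Fin M) ℂ) : T2Space (QMat Q) :=
  inferInstanceAs (T2Space (Matrix (Fin M) (Fin N) ℂ))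

instance {M N : ℕ} (Q : Matrix (Fin N) (Fin M) ℂ) : ContinuousConstSMul ℂ (QMat Q) :=
  inferInstanceAs (ContinuousConstSMul ℂ (Matrix (Fin M) (Fin N) ℂ))

variable {𝕜 : Type*} [RCLike 𝕜] [NormedAlgebra 𝕜 ℂ] {M N : ℕ}

instance (Q : Matrix (Fin N) (Fin M) ℂ) : ContinuousSMul 𝕜 (QMat Q) :=
  inferInstanceAs (ContinuousSMul 𝕜 (Matrix (Fin M) (Fin N) ℂ))

instance (Q : Matrix (Fin N) (Fin M) ℂ) : SMulCommClass 𝕜 ℂ (QMat Q) :=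
  inferInstanceAs (SMulCommClass 𝕜 ℂ (Matrix (Fin M) (Fin N) ℂ))

/-- In a commutative algebra all commutators vanish, and with `W = 0` so does `J`; anticommutators
become twice the product. -/
theorem SolvesOddKPSystem.scalar {D : Set (OddTime → 𝕜)} {f θ : (OddTime → 𝕜) → ℂ}
    (hf : OddSmoothOn D f) (hθ : OddSmoothOn D θ)
    (h : SolvesOddKPSystem D f θ (integral31 f 0)) : SolvesScalarOddKPSystem D f θ := by
  have pd_smul : ∀ (n : OddTime) (c : ℂ) (u : (OddTime → 𝕜) → ℂ), pd n (c • u) = c • pd n u :=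
    fun n c u => funext fun t => deriv_const_mul_field c
  have pd_zero : ∀ n : OddTime, pd n (0 : (OddTime → 𝕜) → ℂ) = 0 := fun n =>
    funext fun t => deriv_const (t n) (0 : ℂ)
  have hJ : integral31 f 0 = 0 := by rw [integral31, com_eq_zero, pd_zero, sub_zero, smul_zero]
  have hac : ∀ a b : (OddTime → 𝕜) → ℂ, acom a b = (2 : ℂ) • (a * b) := fun a b => by
    rw [acom, mul_comm b a, two_smul]
  refine ⟨fun t ht => ?_, fun t ht => ?_⟩
  · have e := h.eq1 t ht
    simp only [hac, com_eq_zero, smul_zero, add_zero] at e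
    refine Eq.trans (congrFun ?_ t) e
    congr 2
    funext s
    simp only [Pi.add_apply, Pi.sub_apply, Pi.smul_apply, Pi.mul_apply, Pi.pow_apply, smul_eq_mul]
    ring
  · have e := h.eq2 t ht
    simp only [hac, hJ, com_eq_zero, smul_zero, add_zero, sub_zero, pd_smul, iterPd, List.foldr,
      pd_zero] at e
    -- Unlike scalar factors, a sum is differentiated termwise only where the terms are
    -- differentiable, hence only at points of `D`.
    have hp : pd t3 (pd t3 θ + (3 : ℂ) • (pd t1 f * pd t1 θ)) t =
        (pd t3 (pd t3 θ) + (3 : ℂ) • pd t3 (pd t1 θ * pd t1 f)) t := by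
      have d1 : HasPd t3 (pd t3 θ) (pd t3 (pd t3 θ) t) t := hθ.isJetFamily.hasPd [t3] t3 t ht
      have d2 : HasPd t3 (pd t1 θ) (pd t3 (pd t1 θ) t) t := hθ.isJetFamily.hasPd [t1] t3 t ht
      have d3 : HasPd t3 (pd t1 f) (pd t3 (pd t1 f) t) t := hf.isJetFamily.hasPd [t1] t3 t ht
      have d4 : HasPd t3 (pd t1 θ * pd t1 f) (pd t3 (pd t1 θ * pd t1 f) t) t :=
        (HasDerivAt.mul d2 d3).differentiableAt.hasDerivAt
      rw [mul_comm (pd t1 f)]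
      exact (d1.add (d4.const_smul 3)).pd_eq
    refine Eq.trans ?_ e
    rw [Pi.sub_apply, Pi.smul_apply, hp]
    have hb : (9 : ℂ) • pd t5 θ - (5 : ℂ) • iterPd [t1, t1, t3] θ + iterPd [t1, t1, t1, t1, t1] θ
        - (15 : ℂ) • (pd t3 f * pd t1 θ) + (15 : ℂ) • (pd t1 f * iterPd [t1, t1, t1] θ)
        + (15 / 2 : ℂ) • pd t1 (iterPd [t1, t1] f * pd t1 θ)
        + (45 : ℂ) • ((pd t1 f) ^ 2 * pd t1 θ) =
        (9 : ℂ) • pd t5 θ - (5 : ℂ) • pd t1 (pd t1 (pd t3 θ))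
        + pd t1 (pd t1 (pd t1 (pd t1 (pd t1 θ))))
        + (15 / 2 : ℂ) • (- (2 : ℂ) • (pd t3 f * pd t1 θ)
          + (2 : ℂ) • (pd t1 (pd t1 (pd t1 θ)) * pd t1 f)
          + (1 / 2 : ℂ) • (2 : ℂ) • pd t1 (pd t1 θ * pd t1 (pd t1 f))
          + (6 : ℂ) • (pd t1 f * pd t1 θ * pd t1 f)) := by
      rw [mul_comm (pd t1 θ) (pd t1 (pd t1 f))]
      funext s
      simp only [Pi.add_apply, Pi.sub_apply, Pi.smul_apply, Pi.mul_apply, Pi.pow_apply,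
        smul_eq_mul, iterPd, List.foldr]
      ring
    rw [hb]
    simp only [Pi.add_apply, Pi.sub_apply, Pi.smul_apply, smul_eq_mul, neg_smul]
    ring

variable {R : Matrix (Fin N) (Fin N) ℂ} {Q : Matrix (Fin N) (Fin M) ℂ}
  {S : Matrix (Fin M) (Fin N) ℂ} {L : Matrix (Fin M) (Fin M) ℂ}
  {D : Set (OddTime → 𝕜)} {Φ : (OddTime → 𝕜) → Matrix (Fin M) (Fin N) ℂ}

/-- One statement serves all three targets. The integral `W` is chosen in the target `A` and need
not be the image of one in `QMat Q`. -/
theorem SolvesOddRiccati.solvesOddKP (hΦ : SolvesOddRiccati (fromBlocks R Q S L) D Φ)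
    (hD : OddOpen D) {A : Type*} [NonUnitalRing A] [Module 𝕜 A]
    [TopologicalSpace A] [Module ℂ A] [ContinuousSMul 𝕜 A] [ContinuousAdd A] [SMulCommClass 𝕜 ℂ A]
    [ContinuousConstSMul ℂ A] [T2Space A] [IsScalarTower ℂ A A] [SMulCommClass ℂ A A]
    (ψ : QMat Q →ₙₐ[ℂ] A) (g : Matrix (Fin M) (Fin N) ℂ →L[𝕜] A) (hg : ∀ X, ψ X = g X)
    {f θ W : (OddTime → 𝕜) → A} (hf : ∀ t, f t = g (Φ t))
    (hθ : ∀ t, θ t + (1 / 2 : ℂ) • W t = g ((1 / 2 : ℂ) • (L * Φ t + Φ t * R)))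
    (hW : OddSmoothOn D W) (hWt : ∀ t ∈ D, pd t1 W t = com f (pd t1 f) t) :
    SolvesOddKP D f θ W ∧ SolvesOddKPSystem D f θ (integral31 f W) := by
  have hev := hΦ.isRealization ψ g hg
  have hs := PolyMat.isKPSolution R Q S L
  have hf' : ∀ t, f t = ψ.comp (PolyMat.evalAt Q (Φ t)) (PolyMat.phi Q) := fun t =>
    (hf t).trans ((hg _).symm.trans (congrArg ψ (PolyMat.evalAt_phi Q (Φ t)).symm))
  have hθ' : ∀ t, θ t + (1 / 2 : ℂ) • W t =
      ψ.comp (PolyMat.evalAt Q (Φ t)) (PolyMat.theta R Q L) := fun t =>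
    (hθ t).trans ((hg _).symm.trans (congrArg ψ (PolyMat.evalAt_theta R Q L (Φ t)).symm))
  exact ⟨hev.solvesOddKP hD hs hf' hθ' hW hWt, hev.solvesOddKPSystem hD hs hf' hθ' hW hWt⟩

/-- The compression `X ↦ Uᵀ X V`, as a homomorphism of algebras. -/
noncomputable def compressHom {m : ℕ} (U : Matrix (Fin M) (Fin m) ℂ) (V : Matrix (Fin N) (Fin m) ℂ)
    (hQ : Q = V * Uᵀ) : QMat Q →ₙₐ[ℂ] Matrix (Fin m) (Fin m) ℂ where
  toFun (X : Matrix (Fin M) (Fin N) ℂ) := Uᵀ * X * V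
  map_smul' c (X : Matrix (Fin M) (Fin N) ℂ) := by
    change Uᵀ * (c • X) * V = c • (Uᵀ * X * V)
    rw [Matrix.mul_smul, Matrix.smul_mul]
  map_zero' := by
    change Uᵀ * (0 : Matrix (Fin M) (Fin N) ℂ) * V = 0
    rw [Matrix.mul_zero, Matrix.zero_mul]
  map_add' (X Y : Matrix (Fin M) (Fin N) ℂ) := by
    change Uᵀ * (X + Y) * V = Uᵀ * X * V + Uᵀ * Y * V
    rw [Matrix.mul_add, Matrix.add_mul]
  map_mul' (X Y : Matrix (Fin M) (Fin N) ℂ) := by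
    change Uᵀ * (X * Q * Y) * V = Uᵀ * X * V * (Uᵀ * Y * V)
    simp only [hQ, Matrix.mul_assoc]

/-- The bilinear form `X ↦ u · X v`, as a homomorphism of algebras. -/
noncomputable def bilinHom (u : Fin M → ℂ) (v : Fin N → ℂ) (hQ : Q = vecMulVec v u) :
    QMat Q →ₙₐ[ℂ] ℂ where
  toFun (X : Matrix (Fin M) (Fin N) ℂ) := u ⬝ᵥ (X *ᵥ v)
  map_smul' c (X : Matrix (Fin M) (Fin N) ℂ) := by
    change u ⬝ᵥ ((c • X) *ᵥ v) = c • (u ⬝ᵥ (X *ᵥ v))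
    rw [smul_mulVec, dotProduct_smul]
  map_zero' := by
    change u ⬝ᵥ ((0 : Matrix (Fin M) (Fin N) ℂ) *ᵥ v) = 0
    rw [zero_mulVec, dotProduct_zero]
  map_add' (X Y : Matrix (Fin M) (Fin N) ℂ) := by
    change u ⬝ᵥ ((X + Y) *ᵥ v) = u ⬝ᵥ (X *ᵥ v) + u ⬝ᵥ (Y *ᵥ v)
    rw [add_mulVec, dotProduct_add]
  map_mul' (X Y : Matrix (Fin M) (Fin N) ℂ) := by
    change u ⬝ᵥ ((X * Q * Y) *ᵥ v) = u ⬝ᵥ (X *ᵥ v) * (u ⬝ᵥ (Y *ᵥ v))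
    rw [hQ, Matrix.mul_assoc, ← mulVec_mulVec, ← mulVec_mulVec, vecMulVec_mulVec,
      op_smul_eq_smul, mulVec_smul, dotProduct_smul, smul_eq_mul, mul_comm]

end MainResults

end OddKP

theorem proposition5p1 {𝕜 : Type*} [RCLike 𝕜] [NormedAlgebra 𝕜 ℂ] {M N : ℕ}
    (R : Matrix (Fin N) (Fin N) ℂ) (Q : Matrix (Fin N) (Fin M) ℂ)
    (S : Matrix (Fin M) (Fin N) ℂ) (L : Matrix (Fin M) (Fin M) ℂ)
    (D : Set (OddKP.OddTime → 𝕜)) (hD : OddKP.OddOpen D)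
    (Φ W Θ : (OddKP.OddTime → 𝕜) → Matrix (Fin M) (Fin N) ℂ)
    (hΦ : OddKP.SolvesOddRiccati (Matrix.fromBlocks R Q S L) D Φ)
    (hW : OddKP.OddSmoothOn D W)
    (hWt : ∀ t ∈ D, OddKP.pd OddKP.t1 W t =
      Φ t * Q * OddKP.pd OddKP.t1 Φ t - OddKP.pd OddKP.t1 Φ t * Q * Φ t)
    (hΘ : ∀ t, Θ t = (1 / 2 : ℂ) • (L * Φ t + Φ t * R - W t)) :
    (OddKP.SolvesOddKP (A := OddKP.QMat Q) D Φ Θ W ∧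
      OddKP.SolvesOddKPSystem (A := OddKP.QMat Q) D Φ Θ
        (OddKP.integral31 (A := OddKP.QMat Q) Φ W)) ∧
    (∀ (m : ℕ) (U : Matrix (Fin M) (Fin m) ℂ) (V : Matrix (Fin N) (Fin m) ℂ), Q = V * Uᵀ →
      OddKP.SolvesOddKP D (fun t => Uᵀ * Φ t * V) (fun t => Uᵀ * Θ t * V)
        (fun t => Uᵀ * W t * V) ∧
      OddKP.SolvesOddKPSystem D (fun t => Uᵀ * Φ t * V) (fun t => Uᵀ * Θ t * V)
        (OddKP.integral31 (fun t => Uᵀ * Φ t * V) (fun t => Uᵀ * W t * V))) ∧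
    (∀ (u : Fin M → ℂ) (v : Fin N → ℂ), Q = Matrix.vecMulVec v u →
      OddKP.SolvesOddKP D (fun t => u ⬝ᵥ (Φ t *ᵥ v))
        (fun t => (1 / 2 : ℂ) * (u ⬝ᵥ ((L * Φ t + Φ t * R) *ᵥ v))) 0 ∧
      OddKP.SolvesScalarOddKPSystem D (fun t => u ⬝ᵥ (Φ t *ᵥ v))
        (fun t => (1 / 2 : ℂ) * (u ⬝ᵥ ((L * Φ t + Φ t * R) *ᵥ v)))) := by
  have hΘ' : ∀ t, Θ t + (1 / 2 : ℂ) • W t = (1 / 2 : ℂ) • (L * Φ t + Φ t * R) := fun t => by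
    rw [hΘ]
    module
  refine ⟨?_, fun m U V hQ => ?_, fun u v hQ => ?_⟩
  · exact hΦ.solvesOddKP (A := OddKP.QMat Q) hD (NonUnitalAlgHom.id ℂ (OddKP.QMat Q))
      (ContinuousLinearMap.id 𝕜 (Matrix (Fin M) (Fin N) ℂ)) (fun _ => rfl) (fun _ => rfl) hΘ' hW hWt
  · let g : Matrix (Fin M) (Fin N) ℂ →L[𝕜] Matrix (Fin m) (Fin m) ℂ :=
      { toFun := fun X => Uᵀ * X * V
        map_add' := fun X Y => by rw [Matrix.mul_add, Matrix.add_mul]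
        map_smul' := fun c X => by rw [Matrix.mul_smul, Matrix.smul_mul, RingHom.id_apply]
        cont := by fun_prop }
    have hpd (f : (OddKP.OddTime → 𝕜) → Matrix (Fin M) (Fin N) ℂ) (t : OddKP.OddTime → 𝕜)
        (hf : OddKP.HasPd OddKP.t1 f (OddKP.pd OddKP.t1 f t) t) :
        OddKP.pd OddKP.t1 (fun t => Uᵀ * f t * V) t = Uᵀ * OddKP.pd OddKP.t1 f t * V :=
      OddKP.HasPd.pd_eq (OddKP.hasDerivAt_clm_comp g hf)
    refine hΦ.solvesOddKP hD (OddKP.compressHom U V hQ) g (fun _ => rfl) (fun _ => rfl)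
      (fun t => ?_) (hW.clm_comp hD g) fun t ht => ?_
    · rw [← hΘ']
      change _ = Uᵀ * (Θ t + (1 / 2 : ℂ) • W t) * V
      rw [Matrix.mul_add, Matrix.add_mul, Matrix.mul_smul, Matrix.smul_mul]
    · have h1 : OddKP.HasPd OddKP.t1 Φ (OddKP.pd OddKP.t1 Φ t) t := by
        have h : OddKP.HasPd OddKP.t1 Φ _ t := hΦ OddKP.t1 t ht
        rwa [h.pd_eq]
      have h2 : OddKP.HasPd OddKP.t1 W (OddKP.pd OddKP.t1 W t) t :=
        hW.isJetFamily.hasPd [] OddKP.t1 t ht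
      change _ = Uᵀ * Φ t * V * OddKP.pd OddKP.t1 (fun t => Uᵀ * Φ t * V) t
        - OddKP.pd OddKP.t1 (fun t => Uᵀ * Φ t * V) t * (Uᵀ * Φ t * V)
      -- The factorisation of `Q` turns the `Q`-commutator into the ordinary commutator of the
      -- compressions.
      rw [hpd W t h2, hpd Φ t h1, hWt t ht, hQ]
      simp only [Matrix.mul_sub, Matrix.sub_mul, Matrix.mul_assoc]
  · let g : Matrix (Fin M) (Fin N) ℂ →L[𝕜] ℂ :=
      { toFun := fun X => u ⬝ᵥ (X *ᵥ v)
        map_add' := fun X Y => by rw [Matrix.add_mulVec, dotProduct_add]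
        map_smul' := fun c X => by rw [Matrix.smul_mulVec, dotProduct_smul, RingHom.id_apply]
        cont := by fun_prop }
    have hz : ∀ n, OddKP.pd n (0 : (OddKP.OddTime → 𝕜) → ℂ) = 0 := fun n =>
      funext fun t => deriv_const (t n) (0 : ℂ)
    have h0 : OddKP.OddSmoothOn D (0 : (OddKP.OddTime → 𝕜) → ℂ) :=
      OddKP.IsJetFamily.oddSmoothOn (G := fun _ => 0)
        ⟨fun _ n t _ => hasDerivAt_const (t n) (0 : ℂ), fun _ _ _ _ _ => rfl⟩ hD
    -- Scalar commutators vanish, so 0 is an admissible integral in place of the image of `W`, and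
    -- `θ` loses its `W` term.
    have h := hΦ.solvesOddKP hD (OddKP.bilinHom u v hQ) g (fun _ => rfl)
      (f := fun t => u ⬝ᵥ (Φ t *ᵥ v))
      (θ := fun t => (1 / 2 : ℂ) * (u ⬝ᵥ ((L * Φ t + Φ t * R) *ᵥ v))) (W := 0) (fun _ => rfl)
      (fun t => ?_) h0 fun t _ => ?_
    · exact ⟨h.1, h.2.scalar h.1.smooth_phi h.1.smooth_theta⟩
    · change _ = u ⬝ᵥ (((1 / 2 : ℂ) • (L * Φ t + Φ t * R)) *ᵥ v)
      rw [Matrix.smul_mulVec, dotProduct_smul, Pi.zero_apply, smul_zero, add_zero,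
        smul_eq_mul]
    · rw [hz, OddKP.com_eq_zero]
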